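/- Let $K$ be a totally real number field of degree $n$ over $\mathbb{Q}$ with ring of integers $O_K$, let $\mathbb{A}_f$ be the ring of finite adeles of $\mathbb{Q}$, and let $K(\mathbb{A}_f)=K\otimes_{\mathbb{Q}}\mathbb{A}_f$ be the ring of finite adeles of $K$. For a finite place $v$ of $K$ let $K_v$ be the completion, $r_v$ its valuation ring, $\pi_v$ a prime element of $r_v$ and $\mathfrak{p}_v$ the corresponding prime ideal. Let $I_K$ be the group of nonzero fractional ideals of $K$, and for $\mathfrak{a}=\prod_v\mathfrak{p}_v^{f_v}\in I_K$ put $I(\mathfrak{a})=\{(a_v)_v\in K(\mathbb{A}_f)^\times \mid a_v\in\pi_v^{f_v}r_v^\times\text{ for all finite }v\}$. Let $\chi$ be a Hecke character of $K$, i.e. a continuous homomorphism from the idele group of $K$ to $\mathbb{C}^\times$ that is trivial on $K^\times$, with local components $\chi_v$; we also write $\chi(b)$ for $b\in K(\mathbb{A}_f)^\times$, extending $b$ by $1$ at the infinite places. Let $\mathfrak m$ be the conductor of $\chi$, and for a fractional ideal $\mathfrak{a}$ prime to $\mathfrak m$ put $\chi(\mathfrak{a})=\prod_{v\nmid\mathfrak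 m,\,v\text{ finite}}\chi_v(a_v)$, where $(a_v)_v\in I(\mathfrak{a})$. Let $\Phi_\chi=\prod_v\Phi_v$ on $K(\mathbb{A}_f)$, where $\Phi_v$ is the indicator function of $r_v$ if $\chi_v$ is unramified, and $\Phi_v$ equals $\chi_v^{-1}$ on $r_v^\times$ and $0$ elsewhere if $\chi_v$ is ramified. For $\mathfrak{b}\in I_K$ put $\Phi_{\chi,\mathfrak{b}}(x)=\chi(b)\Phi_\chi(bx)$ with any $b\in I(\mathfrak{b})$ (this does not depend on $b$), and for $\gamma=\sum_j n_j\mathfrak{b}_j\in\mathbb{C}[I_K]$ put $\Phi_{\chi,\gamma}=\sum_j n_j\Phi_{\chi,\mathfrak{b}_j}$. A simple cone $\Lambda=\Lambda(u_1,\dots,u_n)$ is an $n$-tuple of nonzero elements of $K$ that are linearly independent over $\mathbb{Q}$. A Schwartz–Bruhat (locally constant, compactly supported) function $\Phi:K(\mathbb{A}_f)\to\mathbb{C}$ is called regular with respect to $\Lambda$ if - ($P_1$) $\Phi(x_1u_1+\dots+x_nu_n)=0$ for all $(x_1,\dots,x_n)\in\mathbb{A}_f^n$ with $0\in\{x_1,\dots,x_n\}$,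 and - ($P_2$) $\int_{\mathbb{A}_f}\Phi(v+xu_j)\,dx=0$ for all $1\le j\le n$ and all $v\in K(\mathbb{A}_f)$, where $dx$ is a Haar measure on $\mathbb{A}_f$. **Theorem.** Let $\chi$ be a Hecke character of $K$, let $z\in\mathbb{C}[I_K]$, and let $T$ be a finite set of simple cones. Then there is a finite set $Z$ of rational primes such that for all prime ideals $\mathfrak{p},\mathfrak{q}$ of $O_K$ of degree $1$ (i.e. whose norms $N(\mathfrak{p}),N(\mathfrak{q})$ are rational primes) with $N(\mathfrak{p})\ne N(\mathfrak{q})$, $N(\mathfrak{p})\notin Z$ and $N(\mathfrak{q})\notin Z$, the function $\Phi_{\chi,\gamma z}$ is Schwartz–Bruhat and regular with respect to every $\Lambda\in T$, where $$\gamma=(1-N(\mathfrak{p})\chi(\mathfrak{p})\mathfrak{p}^{-1})(1-\chi(\mathfrak{q})^{-1}\mathfrak{q})\in\mathbb{C}[I_K].$$ -/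

import Mathlib

open IsDedekindDomain NumberField MeasureTheory UniformSpace
open scoped nonZeroDivisors WithZero

noncomputable section

namespace CassouNogues

/-! ### Finite adeles and ideles -/

/-- The ring of finite adeles `𝔸_f` of `ℚ`. -/
abbrev QAdele : Type := FiniteAdeleRing ℤ ℚ

/-- The ring `K(𝔸_f)` of finite adeles of `K`, the restricted product of the `K_v`. -/
abbrev KAdele (K : Type*) [Field K] [NumberField K] : Type _ := FiniteAdeleRing (𝓞 K) K

instance compactSpace_integers (u : HeightOneSpectrum ℤ) :
    CompactSpace (u.adicCompletionIntegers ℚ) := by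
  have : Fact (Nat.Prime (Rat.HeightOneSpectrum.primesEquiv u : Nat.Primes).1) :=
    ⟨(Rat.HeightOneSpectrum.primesEquiv u).2⟩
  let e := (Rat.HeightOneSpectrum.adicCompletion.padicEquiv u).toHomeomorph
  have hb : Set.BijOn e (u.adicCompletionIntegers ℚ) _ :=
    Rat.HeightOneSpectrum.adicCompletion.padicEquiv_bijOn u
  refine (isCompact_iff_compactSpace (s := (u.adicCompletionIntegers ℚ : Set (u.adicCompletion ℚ)))).mp ?_
  rw [← e.isCompact_image, hb.image_eq]
  exact isCompact_iff_compactSpace.mpr (PadicInt.compactSpace _)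

instance locallyCompactSpace_QAdele : LocallyCompactSpace QAdele :=
  haveI : Fact (∀ u : HeightOneSpectrum ℤ,
      IsOpen (u.adicCompletionIntegers ℚ : Set (u.adicCompletion ℚ))) :=
    ⟨fun _ ↦ Valued.isOpen_valuationSubring _⟩
  inferInstanceAs (LocallyCompactSpace
    (RestrictedProduct (fun u : HeightOneSpectrum ℤ ↦ u.adicCompletion ℚ)
      (fun u ↦ (u.adicCompletionIntegers ℚ : Set (u.adicCompletion ℚ))) Filter.cofinite))

instance measurableSpace_QAdele : MeasurableSpace QAdele := borel _

instance borelSpace_QAdele : BorelSpace QAdele := ⟨rfl⟩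

variable {K : Type*} [Field K] [NumberField K]

/-- The prime of `ℤ` below a finite place of `K`. -/
abbrev below (v : HeightOneSpectrum (𝓞 K)) : HeightOneSpectrum ℤ :=
  HeightOneSpectrum.under ℤ v

theorem uniformContinuous_local (v : HeightOneSpectrum (𝓞 K)) :
    UniformContinuous (algebraMap (WithVal ((below v).valuation ℚ)) (WithVal (v.valuation K))) :=
  haveI : v.asIdeal.LiesOver (below v).asIdeal := ⟨rfl⟩
  HeightOneSpectrum.uniformContinuous_algebraMap_liesOver ℚ K (below v) v

/-- The inclusion `ℚ_p → K_v` of completions for `v ∣ p`, the continuous extension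
of `ℚ → K`. -/
def localMap (v : HeightOneSpectrum (𝓞 K)) :
    (below v).adicCompletion ℚ →+* v.adicCompletion K where
  toFun x := .ofCompletion (Completion.map
    (algebraMap (WithVal ((below v).valuation ℚ)) (WithVal (v.valuation K))) x.toCompletion)
  map_zero' := by
    apply HeightOneSpectrum.adicCompletion.ext
    simp only [HeightOneSpectrum.adicCompletion.toCompletion_zero]
    rw [← Completion.coe_zero, Completion.map_coe (uniformContinuous_local v), map_zero,
      Completion.coe_zero]
  map_one' := by
    apply HeightOneSpectrum.adicCompletion.ext
    simp only [HeightOneSpectrum.adicCompletion.toCompletion_one]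
    rw [← Completion.coe_one, Completion.map_coe (uniformContinuous_local v), map_one,
      Completion.coe_one]
  map_add' x y := by
    apply HeightOneSpectrum.adicCompletion.ext
    simp only [HeightOneSpectrum.adicCompletion.toCompletion_add]
    induction x.toCompletion, y.toCompletion using Completion.induction_on₂ with
    | hp =>
      have := Completion.continuous_map (f := algebraMap (WithVal ((below v).valuation ℚ))
        (WithVal (v.valuation K)))
      exact isClosed_eq (by fun_prop) (by fun_prop)
    | ih a b =>
      rw [← Completion.coe_add, Completion.map_coe (uniformContinuous_local v),
        Completion.map_coe (uniformContinuous_local v),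
        Completion.map_coe (uniformContinuous_local v), map_add, Completion.coe_add]
  map_mul' x y := by
    apply HeightOneSpectrum.adicCompletion.ext
    simp only [HeightOneSpectrum.adicCompletion.toCompletion_mul]
    induction x.toCompletion, y.toCompletion using Completion.induction_on₂ with
    | hp =>
      have := Completion.continuous_map (f := algebraMap (WithVal ((below v).valuation ℚ))
        (WithVal (v.valuation K)))
      exact isClosed_eq (by fun_prop) (by fun_prop)
    | ih a b =>
      rw [← Completion.coe_mul, Completion.map_coe (uniformContinuous_local v),
        Completion.map_coe (uniformContinuous_local v),
        Completion.map_coe (uniformContinuous_local v), map_mul, Completion.coe_mul]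

theorem localMap_mapsTo (v : HeightOneSpectrum (𝓞 K)) :
    Set.MapsTo (localMap v) ((below v).adicCompletionIntegers ℚ) (v.adicCompletionIntegers K) := by
  have : v.asIdeal.LiesOver (below v).asIdeal := ⟨rfl⟩
  suffices H : ∀ x : ((below v).valuation ℚ).Completion, Valued.v x ≤ 1 →
      Valued.v (Completion.map (algebraMap (WithVal ((below v).valuation ℚ))
        (WithVal (v.valuation K))) x : (v.valuation K).Completion) ≤ 1 from
    fun x hx ↦ H x.toCompletion hx
  intro x
  induction x using Completion.induction_on with
  | hp =>
    refine isClosed_imp (Valued.isClopen_valuationSubring ((below v).valuation ℚ).Completion).2 ?_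
    exact (Valued.isClosed_valuationSubring (v.valuation K).Completion).preimage
      Completion.continuous_map
  | ih a =>
    rw [Completion.map_coe (uniformContinuous_local v), Valued.valuedCompletion_apply,
      Valued.valuedCompletion_apply]
    intro h
    have e := HeightOneSpectrum.valuation_liesOver K (below v) v (WithVal.ofVal a)
    have h' : (below v).valuation ℚ (WithVal.ofVal a) ≤ 1 := h
    change v.valuation K (algebraMap ℚ K (WithVal.ofVal a)) ≤ 1
    rw [← e]
    exact pow_le_one₀ zero_le h'

theorem tendsto_below :
    Filter.Tendsto (below : HeightOneSpectrum (𝓞 K) → _) Filter.cofinite Filter.cofinite := by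
  refine Filter.Tendsto.cofinite_of_finite_preimage_singleton fun u ↦ ?_
  have := u.isMaximal
  have hf : (Ideal.primesOver u.asIdeal (𝓞 K)).Finite := IsDedekindDomain.primesOver_finite u.asIdeal (𝓞 K)
  refine Set.Finite.of_finite_image (f := HeightOneSpectrum.asIdeal) (hf.subset ?_)
    (fun _ _ _ _ h ↦ HeightOneSpectrum.ext h)
  rintro _ ⟨v, hv, rfl⟩
  exact ⟨v.isPrime, ⟨(congrArg HeightOneSpectrum.asIdeal hv).symm⟩⟩

/-- The ring homomorphism `𝔸_f → K(𝔸_f) = K ⊗ 𝔸_f`, with component `ℚ_p → K_v` at `v ∣ p`. -/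
def baseChange : QAdele →+* KAdele K :=
  RestrictedProduct.mapAlongRingHom (fun u : HeightOneSpectrum ℤ ↦ u.adicCompletion ℚ)
    (fun v : HeightOneSpectrum (𝓞 K) ↦ v.adicCompletion K) below tendsto_below
    (fun v ↦ localMap v) (.of_forall localMap_mapsTo)

/-- `x ↦ (1, x)`: the inclusion of the finite ideles into the ideles. -/
def finiteToIdele : (KAdele K)ˣ →* (AdeleRing (𝓞 K) K)ˣ :=
  Units.map
    { toFun := fun a ↦ ((1, a) : InfiniteAdeleRing K × KAdele K)
      map_one' := rfl
      map_mul' := fun _ _ ↦ Prod.ext (one_mul (1 : InfiniteAdeleRing K)).symm rfl }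

open scoped Classical in
/-- The inclusion of `K_vˣ` into the finite ideles (component `1` away from `v`). -/
def localToFinite (v : HeightOneSpectrum (𝓞 K)) : (v.adicCompletion K)ˣ →* (KAdele K)ˣ :=
  Units.map
    { toFun := fun x ↦ RestrictedProduct.mulSingle
        (fun w : HeightOneSpectrum (𝓞 K) ↦ w.adicCompletionIntegers K) v x
      map_one' := RestrictedProduct.mulSingle_one _ _
      map_mul' := RestrictedProduct.mulSingle_mul _ _ }

/-- The component at `v` of a finite idele. -/
def component (v : HeightOneSpectrum (𝓞 K)) : (KAdele K)ˣ →* (v.adicCompletion K)ˣ :=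
  Units.map { toFun := fun a ↦ a v, map_one' := rfl, map_mul' := fun _ _ ↦ rfl }

/-! ### Fractional ideals and ideles -/

variable (K) in
/-- The group `I_K` of nonzero fractional ideals of `K`. -/
abbrev IdealGroup : Type _ := (FractionalIdeal (𝓞 K)⁰ K)ˣ

/-- `I(𝔞)`: the finite ideles `(a_v)` with `a_v ∈ π_v ^ f_v r_vˣ`, that is, of `v`-adic
valuation `f_v`, for every `v`, where `𝔞 = ∏ 𝔭_v ^ f_v`. -/
def idelesOf (𝔞 : IdealGroup K) : Set (KAdele K)ˣ :=
  {a | ∀ v : HeightOneSpectrum (𝓞 K),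
    Valued.v ((a : KAdele K) v) = WithZero.exp (-FractionalIdeal.count K v (𝔞 : _))}

theorem idelesOf_nonempty (𝔞 : IdealGroup K) : (idelesOf 𝔞).Nonempty := by
  choose x hx using fun v : HeightOneSpectrum (𝓞 K) ↦
    v.valuedAdicCompletion_surjective K
      (WithZero.exp (-FractionalIdeal.count K v (𝔞 : FractionalIdeal (𝓞 K)⁰ K)))
  have h1 : ∀ᶠ v in Filter.cofinite, Valued.v (x v) = 1 := by
    filter_upwards [FractionalIdeal.finite_factors (𝔞 : FractionalIdeal (𝓞 K)⁰ K)] with v hv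
    rw [hx, hv, neg_zero, WithZero.exp_zero]
  let y : KAdele K := ⟨x, h1.mono fun v hv ↦ hv.le⟩
  have h2 : IsUnit y :=
    FiniteAdeleRing.isUnit_iff.mpr ⟨fun v h0 ↦ by
      have := hx v
      rw [show x v = 0 from h0, map_zero] at this
      exact WithZero.exp_ne_zero this.symm, h1⟩
  exact ⟨h2.unit, hx⟩

/-- A chosen element of `I(𝔞)`. -/
def ideleOf (𝔞 : IdealGroup K) : (KAdele K)ˣ := (idelesOf_nonempty 𝔞).some

/-- A finite place of `K` as an element of `I_K`. -/
def primeIdeal (v : HeightOneSpectrum (𝓞 K)) : IdealGroup K :=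
  Units.mk0 (v.asIdeal : FractionalIdeal (𝓞 K)⁰ K)
    (FractionalIdeal.coeIdeal_ne_zero.mpr v.ne_bot)

/-! ### Hecke characters -/

variable (K) in
/-- A Hecke character of `K`: a continuous homomorphism from the idele group to `ℂˣ` that is
trivial on `Kˣ`. -/
structure HeckeCharacter where
  toHom : (AdeleRing (𝓞 K) K)ˣ →* ℂˣ
  continuous_toHom : Continuous toHom
  map_principal : ∀ x : Kˣ, toHom (Units.map (algebraMap K (AdeleRing (𝓞 K) K)).toMonoidHom x) = 1

namespace HeckeCharacter

variable (χ : HeckeCharacter K)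

/-- The restriction of `χ` to the finite ideles. -/
def finitePart : (KAdele K)ˣ →* ℂˣ := χ.toHom.comp finiteToIdele

/-- The local component `χ_v` at a finite place. -/
def localComponent (v : HeightOneSpectrum (𝓞 K)) : (v.adicCompletion K)ˣ →* ℂˣ :=
  χ.finitePart.comp (localToFinite v)

/-- `χ_v` is unramified, that is, trivial on `r_vˣ`; equivalently, `v` does not divide the
conductor `𝔪` of `χ`. -/
def IsUnramifiedAt (v : HeightOneSpectrum (𝓞 K)) : Prop :=
  ∀ x : (v.adicCompletion K)ˣ, Valued.v (x : v.adicCompletion K) = 1 → χ.localComponent v x = 1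

/-- `χ_I(𝔞) = ∏_{v ∤ 𝔪} χ_v(a_v)` with `(a_v) ∈ I(𝔞)`: the character of the group of ideals
prime to the conductor attached to `χ`. It is only meaningful for `𝔞` prime to the conductor. -/
def onIdeals (𝔞 : IdealGroup K) : ℂ :=
  ∏ᶠ (v : HeightOneSpectrum (𝓞 K)) (_ : χ.IsUnramifiedAt v),
    (χ.localComponent v (component v (ideleOf 𝔞)) : ℂ)

open scoped Classical in
/-- The local factor `Φ_v` of the standard function: the indicator function of `r_v` if `χ_v` is
unramified, and `χ_v⁻¹` on `r_vˣ`, extended by zero, if `χ_v` is ramified. -/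
def localFunction (v : HeightOneSpectrum (𝓞 K)) (x : v.adicCompletion K) : ℂ :=
  if χ.IsUnramifiedAt v then
    if x ∈ v.adicCompletionIntegers K then 1 else 0
  else
    if h : Valued.v x = 1 then
      ((χ.localComponent v (Units.mk0 x ((Valuation.ne_zero_iff _).mp (h ▸ one_ne_zero))))⁻¹ : ℂˣ)
    else 0

/-- The standard function `Φ_χ = ∏_v Φ_v` on `K(𝔸_f)`. -/
def standardFunction (x : KAdele K) : ℂ :=
  ∏ᶠ v : HeightOneSpectrum (𝓞 K), χ.localFunction v (x v)

/-- `Φ_{χ,𝔟}(x) = χ(b) Φ_χ(b x)` with `b ∈ I(𝔟)`; the value does not depend on `b`. -/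
def idealFunction (𝔟 : IdealGroup K) (x : KAdele K) : ℂ :=
  (χ.finitePart (ideleOf 𝔟) : ℂ) * χ.standardFunction ((ideleOf 𝔟 : KAdele K) * x)

/-- `Φ_{χ,γ} = ∑ n_j Φ_{χ,𝔟_j}` for `γ = ∑ n_j 𝔟_j` in the group ring `ℂ[I_K]`. -/
def groupRingFunction (γ : MonoidAlgebra ℂ (IdealGroup K)) (x : KAdele K) : ℂ :=
  γ.coeff.sum fun 𝔟 n ↦ n * χ.idealFunction 𝔟 x

/-- `γ = (1 - N(𝔭) χ(𝔭) 𝔭⁻¹) (1 - χ⁻¹(𝔮) 𝔮)` in `ℂ[I_K]`. -/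
def smoothing (𝔭 𝔮 : HeightOneSpectrum (𝓞 K)) : MonoidAlgebra ℂ (IdealGroup K) :=
  (1 - MonoidAlgebra.single (primeIdeal 𝔭)⁻¹
      ((Ideal.absNorm 𝔭.asIdeal : ℂ) * χ.onIdeals (primeIdeal 𝔭))) *
    (1 - MonoidAlgebra.single (primeIdeal 𝔮) (χ.onIdeals (primeIdeal 𝔮))⁻¹)

end HeckeCharacter

/-! ### Cones and regularity -/

variable (K) in
/-- The cones `Λ(u_1, …, u_n)` with `u_1, …, u_n ∈ K \ {0}`, where `n = [K : ℚ]`. -/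
abbrev Cone : Type _ := Fin (Module.finrank ℚ K) → {a : K // a ≠ 0}

/-- A cone is simple if its generators are linearly independent over `ℚ`. -/
def Cone.IsSimple (Λ : Cone K) : Prop := LinearIndependent ℚ fun i ↦ (Λ i : K)

/-- Schwartz–Bruhat functions on `K(𝔸_f)`: locally constant with compact support. -/
def IsSchwartzBruhat (Φ : KAdele K → ℂ) : Prop := IsLocallyConstant Φ ∧ HasCompactSupport Φ

/-- Condition `P₁`: `Φ(x_1 u_1 + ⋯ + x_n u_n) = 0` whenever `x ∈ 𝔸_f ^ n` has a zero entry. -/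
def ConditionP1 (Φ : KAdele K → ℂ) (Λ : Cone K) : Prop :=
  ∀ x : Fin (Module.finrank ℚ K) → QAdele, (∃ i, x i = 0) →
    Φ (∑ i, baseChange (x i) * algebraMap K (KAdele K) (Λ i : K)) = 0

/-- Condition `P₂`: `∫_{𝔸_f} Φ(v + x u_j) dx = 0` for all `v` and `j`, where `dx` is a Haar
measure (the condition does not depend on its normalization). -/
def ConditionP2 (Φ : KAdele K → ℂ) (Λ : Cone K) : Prop :=
  ∀ (j : Fin (Module.finrank ℚ K)) (v : KAdele K),
    ∫ x : QAdele, Φ (v + baseChange x * algebraMap K (KAdele K) (Λ j : K))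
      ∂(Measure.addHaar : Measure QAdele) = 0

/-- A Schwartz–Bruhat function that is regular with respect to the cone `Λ`. -/
def IsRegular (Φ : KAdele K → ℂ) (Λ : Cone K) : Prop :=
  IsSchwartzBruhat Φ ∧ ConditionP1 Φ Λ ∧ ConditionP2 Φ Λ

/-! ### Pairs of primes of degree one -/

variable (K) in
/-- `P(K)`: pairs of primes of degree one with distinct norms. -/
def primePairs : Set (HeightOneSpectrum (𝓞 K) × HeightOneSpectrum (𝓞 K)) :=
  {P | (Ideal.absNorm P.1.asIdeal).Prime ∧ (Ideal.absNorm P.2.asIdeal).Prime ∧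
    Ideal.absNorm P.1.asIdeal ≠ Ideal.absNorm P.2.asIdeal}

/-- `A(𝔭, 𝔮)` holds for almost all `(𝔭, 𝔮) ∈ P(K)`: there is a finite set `Z` of rational primes
such that it holds whenever neither norm lies in `Z`. -/
def ForAlmostAllPairs (A : HeightOneSpectrum (𝓞 K) → HeightOneSpectrum (𝓞 K) → Prop) : Prop :=
  ∃ Z : Finset ℕ, (∀ p ∈ Z, p.Prime) ∧
    ∀ 𝔭 𝔮 : HeightOneSpectrum (𝓞 K), (𝔭, 𝔮) ∈ primePairs K →
      Ideal.absNorm 𝔭.asIdeal ∉ Z → Ideal.absNorm 𝔮.asIdeal ∉ Z → A 𝔭 𝔮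

end CassouNogues

end

/-!
# Regularity of the functions `Φ_{χ,γz}`

Since `ℂˣ` has no small subgroups, a Hecke character `χ` is trivial on a subgroup of the finite
ideles given by congruences at finitely many places (`exists_finitePart_eq_one`). Hence `χ` is
unramified almost everywhere, is the product of its local components on `∏ r_vˣ`, and `Φ_χ` is
locally constant with support in the compact set `∏ r_v`. Moreover `Φ_{χ,z}` is unramified outside a
finite set `S₀` of places (`IsUnramifiedOutside`): there it depends only on whether the components
of its argument are integral, and it vanishes unless they all are.

If `π_𝔞` denotes an idele with ideal `𝔞`, multiplication of `z` by `𝔞` turns `Φ_{χ,z}` into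
`χ(π_𝔞) Φ_{χ,z}(π_𝔞 x)`. So the factors `χ(𝔭)` and `χ(𝔮)⁻¹` in `γ` cancel those coming from `χ`, and
`Φ_{χ,γz}` arises from `Φ_{χ,z}` by the two commuting difference operators `1 - N(𝔭) (π_𝔭⁻¹)^*` and
`1 - (π_𝔮)^*` (`groupRingFunction_smoothing_mul`). The set `Z` consists of the primes below the
places in `S₀`, the ramified places, and the finitely many places that are bad for the cones.

The operator at `𝔭` gives `P₂`. Let `p = N(𝔭)`. For `y` integral above `p`, exactly one of
the translates `y + a u_j`, `0 ≤ a < p`, taken in the components above `p`, is divisible by `𝔭`,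
because the residue field is `𝔽_p`. Hence the sum of `Φ_{χ,γz}` over these translates vanishes
(`sum_translates_eq_zero`). The translates differ by elements of `𝔸_f u_j`, so invariance of the
Haar measure shows that `p` times the integral in `P₂` is zero.

The operator at `𝔮` gives `P₁`. Let `q = N(𝔮)`. The function is supported on adeles with a simple
pole at `𝔮` that are integral at the other places above `q`. Approximating coordinates at `q`, it
suffices to show that `l(y) ≠ 0` for `y ∈ K` with this property and `l` a coordinate functional of
the cone (`exists_functional_ne_zero`). Every `s ∈ O_K` is congruent modulo `𝔮` to some integer `b`,
and `y (s - b)` is integral above `q`; if `l(y)` were zero, `l(y s)` would be `q`-integral for every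
`s`, and duality with respect to the form `l(x y)` would make `y` integral at `𝔮`.
-/

open IsDedekindDomain NumberField MeasureTheory UniformSpace
open scoped nonZeroDivisors WithZero

noncomputable section

namespace CassouNogues

variable {K : Type*} [Field K] [NumberField K]

/-! ### Completions at finite places -/

section Local

variable {R F : Type*} [CommRing R] [IsDedekindDomain R] [Field F] [Algebra R F]
  [IsFractionRing R F] (v : HeightOneSpectrum R)

theorem mem_nhds_zero_iff_exists_ball {U : Set (v.adicCompletion F)} :
    U ∈ nhds 0 ↔ ∃ ε : ℤᵐ⁰, ε ≠ 0 ∧ ∀ x : v.adicCompletion F, Valued.v x < ε → x ∈ U := by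
  rw [Valued.mem_nhds_zero]
  constructor
  · rintro ⟨γ, hγ⟩
    refine ⟨MonoidWithZeroHom.ValueGroup₀.embedding γ.1, ?_,
      fun x hx ↦ hγ ?_⟩
    · rw [map_ne_zero]
      exact γ.ne_zero
    · exact (Valuation.restrict_lt_iff_lt_embedding _).mpr hx
  · rintro ⟨ε, hε, h⟩
    obtain ⟨r, hr⟩ := v.valuedAdicCompletion_surjective F ε
    refine ⟨Units.mk0 (Valued.v.restrict r) ?_, fun x hx ↦ h x ?_⟩
    · rw [Ne, Valuation.restrict_eq_zero_iff, hr]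
      exact hε
    · rw [← hr]
      exact (Valuation.restrict_lt_iff _).mp hx

theorem exists_field_sub_lt (x : v.adicCompletion F) {ε : ℤᵐ⁰} (hε : ε ≠ 0) :
    ∃ k : F, Valued.v (x - (k : v.adicCompletion F)) < ε := by
  have hU : {y : v.adicCompletion F | Valued.v (x - y) < ε} ∈ nhds x := by
    have h0 : {y : v.adicCompletion F | Valued.v y < ε} ∈ nhds (x - x) := by
      rw [sub_self]
      exact (mem_nhds_zero_iff_exists_ball v).mpr ⟨ε, hε, fun _ h ↦ h⟩
    exact (continuous_const.sub continuous_id).continuousAt.preimage_mem_nhds h0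
  obtain ⟨k, hk⟩ := (HeightOneSpectrum.denseRange_algebraMap F v).exists_mem_open
    (isOpen_interior (s := {y : v.adicCompletion F | Valued.v (x - y) < ε}))
    ⟨x, mem_interior_iff_mem_nhds.mpr hU⟩
  have hk' : algebraMap F (v.adicCompletion F) k ∈
      {y : v.adicCompletion F | Valued.v (x - y) < ε} := interior_subset hk
  exact ⟨k, hk'⟩

theorem exists_integer_sub_lt {x : v.adicCompletion F} (hx : Valued.v x ≤ 1) {ε : ℤᵐ⁰}
    (hε : ε ≠ 0) :
    ∃ s : R, Valued.v (x - ((algebraMap R F s : F) : v.adicCompletion F)) < ε := by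
  obtain ⟨k, hk⟩ := exists_field_sub_lt v x
    (lt_min (zero_lt_iff.mpr hε) one_pos).ne'
  have hk1 : v.valuation F k ≤ 1 := by
    rw [← HeightOneSpectrum.valuedAdicCompletion_eq_valuation']
    have : (k : v.adicCompletion F) = x - (x - k) := by ring
    rw [this]
    exact (Valuation.map_sub _ _ _).trans (max_le hx (hk.le.trans (min_le_right _ _)))
  obtain ⟨s, hs⟩ := HeightOneSpectrum.exists_valuation_sub_lt_of_integer v hk1 (Units.mk0 ε hε)
  refine ⟨s, ?_⟩
  have e : x - ((algebraMap R F s : F) : v.adicCompletion F)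
      = (x - (k : v.adicCompletion F)) - ((algebraMap R F s - k : F) : v.adicCompletion F) := by
    have : ((algebraMap R F s - k : F) : v.adicCompletion F)
      = ((algebraMap R F s : F) : v.adicCompletion F) - (k : v.adicCompletion F) :=
        map_sub (algebraMap F (v.adicCompletion F)) _ _
    rw [this]
    ring
  rw [e]
  refine (Valuation.map_sub _ _ _).trans_lt (max_lt (hk.trans_le (min_le_left _ _)) ?_)
  rw [HeightOneSpectrum.valuedAdicCompletion_eq_valuation']
  exact hs

/-- The valuation ring is totally bounded because its elements are congruent to elements of the
finite rings `R / 𝔭 ^ n`. -/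
theorem isCompact_adicCompletionIntegers [Ring.HasFiniteQuotients R] :
    IsCompact (v.adicCompletionIntegers F : Set (v.adicCompletion F)) := by
  rw [isCompact_iff_totallyBounded_isComplete]
  refine ⟨?_, (Valued.isClosed_valuationSubring _).isComplete⟩
  rw [totallyBounded_iff_subset_finite_iUnion_nhds_zero]
  intro U hU
  obtain ⟨ε, hε, hεU⟩ := (mem_nhds_zero_iff_exists_ball v).mp hU
  obtain ⟨n, hn⟩ : ∃ n : ℕ, WithZero.exp (-(n : ℤ)) < ε := by
    obtain ⟨n, hn, -⟩ := WithZero.exists_exp_neg_natCast_lt_and_lt hε hε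
    exact ⟨n, hn⟩
  have hfin : Finite (R ⧸ v.asIdeal ^ n) :=
    Ring.HasFiniteQuotients.finiteQuotient (pow_ne_zero n v.ne_bot)
  refine ⟨Set.range fun a : R ⧸ v.asIdeal ^ n ↦
    ((algebraMap R F a.out : F) : v.adicCompletion F), Set.finite_range _, fun x hx ↦ ?_⟩
  obtain ⟨s, hs⟩ := exists_integer_sub_lt v (x := x) hx hε
  simp only [Set.mem_iUnion, Set.mem_range, exists_prop, exists_exists_eq_and]
  refine ⟨Ideal.Quotient.mk _ s, ?_⟩
  rw [Set.mem_vadd_set_iff_neg_vadd_mem, vadd_eq_add, neg_add_eq_sub]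
  refine hεU _ ?_
  set r : R := (Ideal.Quotient.mk (v.asIdeal ^ n) s).out with hr
  have hsr : s - r ∈ v.asIdeal ^ n := by
    rw [← Ideal.Quotient.eq, hr, Ideal.Quotient.mk_out]
  have e : x - ((algebraMap R F r : F) : v.adicCompletion F)
      = (x - ((algebraMap R F s : F) : v.adicCompletion F))
        + ((algebraMap R F (s - r) : F) : v.adicCompletion F) := by
    have : ((algebraMap R F (s - r) : F) : v.adicCompletion F)
      = ((algebraMap R F s : F) : v.adicCompletion F)
        - ((algebraMap R F r : F) : v.adicCompletion F) := by
      rw [map_sub]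
      exact map_sub (algebraMap F (v.adicCompletion F)) _ _
    rw [this]
    ring
  rw [e]
  refine (Valuation.map_add _ _ _).trans_lt (max_lt hs ?_)
  rw [HeightOneSpectrum.valuedAdicCompletion_eq_valuation',
    HeightOneSpectrum.valuation_of_algebraMap]
  exact ((HeightOneSpectrum.intValuation_le_pow_iff_mem v _ n).mpr hsr).trans_lt hn

@[simp] theorem adele_add_apply (x y : FiniteAdeleRing R F) : (x + y) v = x v + y v := rfl

@[simp] theorem adele_mul_apply (x y : FiniteAdeleRing R F) : (x * y) v = x v * y v := rfl

@[simp] theorem adele_sub_apply (x y : FiniteAdeleRing R F) : (x - y) v = x v - y v := rfl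

@[simp] theorem adele_zero_apply : (0 : FiniteAdeleRing R F) v = 0 := rfl

@[simp] theorem adele_sum_apply {ι : Type*} (s : Finset ι) (f : ι → FiniteAdeleRing R F) :
    (∑ i ∈ s, f i) v = ∑ i ∈ s, f i v := by
  classical
  induction s using Finset.induction_on with
  | empty => simp
  | insert i s hi ih => simp [Finset.sum_insert hi, ih]

/-- The inclusion of `∏ r_v` into the finite adeles. -/
def integralAdele (x : ∀ v : HeightOneSpectrum R, v.adicCompletionIntegers F) :
    FiniteAdeleRing R F :=
  ⟨fun v ↦ x v, .of_forall fun v ↦ (x v).2⟩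

variable (R F) in
theorem isOpenEmbedding_integralAdele :
    Topology.IsOpenEmbedding (integralAdele : (∀ v : HeightOneSpectrum R,
      v.adicCompletionIntegers F) → FiniteAdeleRing R F) :=
  RestrictedProduct.isOpenEmbedding_structureMap
    (R := fun v : HeightOneSpectrum R ↦ v.adicCompletion F)
    (A := fun v : HeightOneSpectrum R ↦ (v.adicCompletionIntegers F : Set (v.adicCompletion F)))
    fun _ ↦ Valued.isOpen_valuationSubring _

variable (R F) in
/-- The integral finite adeles `∏ r_v`. -/
def integralAdeles : Set (FiniteAdeleRing R F) := {x | ∀ v, Valued.v (x v) ≤ 1}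

theorem range_integralAdele :
    Set.range (integralAdele : _ → FiniteAdeleRing R F) = integralAdeles R F := by
  ext x
  constructor
  · rintro ⟨y, rfl⟩ v
    exact (y v).2
  · intro h
    exact ⟨fun v ↦ ⟨x v, h v⟩, rfl⟩

theorem isOpen_integralAdeles : IsOpen (integralAdeles R F) := by
  rw [← range_integralAdele]
  exact (isOpenEmbedding_integralAdele R F).isOpen_range

theorem isCompact_integralAdeles [Ring.HasFiniteQuotients R] :
    IsCompact (integralAdeles R F) := by
  have (v : HeightOneSpectrum R) : CompactSpace (v.adicCompletionIntegers F) :=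
    isCompact_iff_compactSpace.mp (isCompact_adicCompletionIntegers v)
  rw [← range_integralAdele]
  exact isCompact_range (isOpenEmbedding_integralAdele R F).continuous

instance : T2Space (FiniteAdeleRing R F) :=
  inferInstanceAs (T2Space (RestrictedProduct (fun v : HeightOneSpectrum R ↦ v.adicCompletion F)
    (fun v ↦ (v.adicCompletionIntegers F : Set (v.adicCompletion F))) Filter.cofinite))

theorem continuous_adele_eval (v : HeightOneSpectrum R) :
    Continuous fun x : FiniteAdeleRing R F ↦ x v :=
  RestrictedProduct.continuous_eval
    (R := fun v : HeightOneSpectrum R ↦ v.adicCompletion F)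
    (A := fun v ↦ (v.adicCompletionIntegers F : Set (v.adicCompletion F)))
    (𝓕 := Filter.cofinite) v

theorem exists_ball_subset_of_mem_nhds_zero {N : Set (FiniteAdeleRing R F)} (hN : N ∈ nhds 0) :
    ∃ (S : Finset (HeightOneSpectrum R)) (ε : HeightOneSpectrum R → ℤᵐ⁰), (∀ v, ε v ≠ 0) ∧
      ∀ y : FiniteAdeleRing R F, (∀ v, Valued.v (y v) ≤ 1) →
        (∀ v ∈ S, Valued.v (y v) < ε v) → y ∈ N := by
  have hN' : integralAdele ⁻¹' N ∈
      nhds (0 : ∀ v : HeightOneSpectrum R, v.adicCompletionIntegers F) :=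
    (isOpenEmbedding_integralAdele R F).continuous.continuousAt.preimage_mem_nhds hN
  rw [nhds_pi, Filter.mem_pi] at hN'
  obtain ⟨I, hI, t, ht, hsub⟩ := hN'
  have h2 : ∀ v, ∃ ε : ℤᵐ⁰, ε ≠ 0 ∧ ∀ x : v.adicCompletionIntegers F,
      Valued.v (x : v.adicCompletion F) < ε → x ∈ t v := by
    intro v
    obtain ⟨s, hs, hst⟩ := mem_nhds_induced _ _ _ |>.mp (ht v)
    obtain ⟨ε, hε, hs⟩ := (mem_nhds_zero_iff_exists_ball v).mp hs
    exact ⟨ε, hε, fun x hx ↦ hst (hs _ hx)⟩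
  choose ε hε0 hε using h2
  refine ⟨hI.toFinset, ε, hε0, fun y hy hyS ↦ ?_⟩
  let w : ∀ v : HeightOneSpectrum R, v.adicCompletionIntegers F := fun v ↦ ⟨y v, hy v⟩
  have hw : w ∈ I.pi t := fun v hv ↦ hε v (w v) (hyS v (hI.mem_toFinset.mpr hv))
  exact hsub hw

end Local

/-! ### Local components of Hecke characters -/

/-- The subgroup generated by `z ≠ 1` leaves the disc of radius `1 / 2` around `1`: squaring an
element of the disc multiplies the distance to `1` by at least `3 / 2`. -/
theorem eq_one_of_forall_norm_pow_sub_one_le {z : ℂ} (h : ∀ n : ℕ, ‖z ^ n - 1‖ ≤ 1 / 2) :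
    z = 1 := by
  have key : ∀ n : ℕ, (3 / 2 : ℝ) ^ n * ‖z - 1‖ ≤ ‖z ^ 2 ^ n - 1‖ := by
    intro n
    induction n with
    | zero => simp
    | succ n ih =>
      have e : z ^ 2 ^ (n + 1) - 1 = (z ^ 2 ^ n + 1) * (z ^ 2 ^ n - 1) := by ring
      have h1 : (3 / 2 : ℝ) ≤ ‖z ^ 2 ^ n + 1‖ := by
        have h2 : ‖(2 : ℂ)‖ ≤ ‖z ^ 2 ^ n + 1‖ + ‖z ^ 2 ^ n - 1‖ := by
          refine le_trans (le_of_eq ?_) (norm_sub_le _ _)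
          congr 1
          ring
        have h3 := h (2 ^ n)
        have h4 : ‖(2 : ℂ)‖ = 2 := by simp
        linarith
      rw [e, norm_mul, pow_succ']
      calc 3 / 2 * (3 / 2 : ℝ) ^ n * ‖z - 1‖ = 3 / 2 * ((3 / 2 : ℝ) ^ n * ‖z - 1‖) := by ring
        _ ≤ _ := mul_le_mul h1 ih (by positivity) (norm_nonneg _)
  by_contra hz
  have hpos : 0 < ‖z - 1‖ := norm_pos_iff.mpr (sub_ne_zero.mpr hz)
  obtain ⟨n, hn⟩ := pow_unbounded_of_one_lt (1 / ‖z - 1‖) (by norm_num : (1 : ℝ) < 3 / 2)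
  have h1 := (key n).trans (h _)
  rw [div_lt_iff₀ hpos] at hn
  linarith

theorem continuous_finitePart (χ : HeckeCharacter K) : Continuous χ.finitePart := by
  refine χ.continuous_toHom.comp (Continuous.units_map _ ?_)
  exact (continuous_const.prodMk continuous_id :
    Continuous fun a : KAdele K ↦ ((1, a) : InfiniteAdeleRing K × KAdele K))

@[simp] theorem component_apply (v : HeightOneSpectrum (𝓞 K)) (a : (KAdele K)ˣ) :
    (component v a : v.adicCompletion K) = (a : KAdele K) v := rfl

theorem units_inv_apply (a : (KAdele K)ˣ) (v : HeightOneSpectrum (𝓞 K)) :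
    ((a⁻¹ : (KAdele K)ˣ) : KAdele K) v = ((a : KAdele K) v)⁻¹ := by
  rw [← component_apply, ← component_apply, map_inv, Units.val_inv_eq_inv_val]

/-- `ℂˣ` has no small subgroups, hence `χ` is trivial on a subgroup of finite ideles that is given
by congruence conditions at finitely many places. -/
theorem exists_finitePart_eq_one (χ : HeckeCharacter K) :
    ∃ (S : Finset (HeightOneSpectrum (𝓞 K))) (ε : HeightOneSpectrum (𝓞 K) → ℤᵐ⁰),
      (∀ v, ε v ≠ 0) ∧ ∀ a : (KAdele K)ˣ, (∀ v, Valued.v ((a : KAdele K) v) = 1) →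
        (∀ v ∈ S, Valued.v ((a : KAdele K) v - 1) < ε v) → χ.finitePart a = 1 := by
  have hV : {a : (KAdele K)ˣ | ‖(χ.finitePart a : ℂ) - 1‖ < 1 / 2} ∈ nhds 1 := by
    have hc : Continuous fun a : (KAdele K)ˣ ↦ ‖(χ.finitePart a : ℂ) - 1‖ :=
      ((Units.continuous_val.comp (continuous_finitePart χ)).sub continuous_const).norm
    refine hc.continuousAt.preimage_mem_nhds (Iio_mem_nhds ?_)
    simp
  rw [Units.isInducing_embedProduct.nhds_eq_comap, Filter.mem_comap] at hV
  obtain ⟨t, ht, hV⟩ := hV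
  obtain ⟨N₁, hN₁, N₂, hN₂, ht⟩ := mem_nhds_prod_iff.mp ht
  have hN : (fun y : KAdele K ↦ y + 1) ⁻¹' (N₁ ∩ MulOpposite.op ⁻¹' N₂) ∈ nhds 0 := by
    refine (continuous_id.add continuous_const).continuousAt.preimage_mem_nhds ?_
    change _ ∈ nhds ((0 : KAdele K) + 1)
    rw [zero_add]
    exact Filter.inter_mem hN₁ (MulOpposite.continuous_op.continuousAt.preimage_mem_nhds hN₂)
  obtain ⟨S, ε, hε, hN⟩ := exists_ball_subset_of_mem_nhds_zero hN
  have key : ∀ a : (KAdele K)ˣ, (∀ v, Valued.v ((a : KAdele K) v) = 1) →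
      (∀ v ∈ S, Valued.v ((a : KAdele K) v - 1) < ε v) →
      (a : KAdele K) ∈ N₁ ∩ MulOpposite.op ⁻¹' N₂ := by
    intro a ha haS
    have := hN ((a : KAdele K) - 1) (fun v ↦ ?_) haS
    · simpa using this
    · exact (Valuation.map_sub _ _ _).trans (max_le (ha v).le Valued.v.map_one.le)
  refine ⟨S, ε, hε, fun a ha haS ↦ Units.ext (eq_one_of_forall_norm_pow_sub_one_le fun n ↦ ?_)⟩
  have hpow : ∀ n : ℕ, ∀ v ∈ S, Valued.v (((a ^ n : (KAdele K)ˣ) : KAdele K) v - 1) < ε v := by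
    intro n v hv
    induction n with
    | zero =>
      have : ((a ^ 0 : (KAdele K)ˣ) : KAdele K) v - 1 = 0 := by
        rw [pow_zero]
        exact sub_self _
      rw [this, map_zero]
      exact zero_lt_iff.mpr (hε v)
    | succ n ih =>
      have : ((a ^ (n + 1) : (KAdele K)ˣ) : KAdele K) v - 1
          = (a : KAdele K) v * (((a ^ n : (KAdele K)ˣ) : KAdele K) v - 1)
            + ((a : KAdele K) v - 1) := by
        rw [pow_succ']
        change (a : KAdele K) v * ((a ^ n : (KAdele K)ˣ) : KAdele K) v - 1 = _
        ring
      rw [this]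
      refine (Valuation.map_add _ _ _).trans_lt (max_lt ?_ (haS v hv))
      rw [map_mul, ha, one_mul]
      exact ih
  have hpow1 : ∀ n : ℕ, ∀ v, Valued.v (((a ^ n : (KAdele K)ˣ) : KAdele K) v) = 1 := by
    intro n v
    rw [← component_apply, map_pow, Units.val_pow_eq_pow_val, map_pow, component_apply, ha,
      one_pow]
  rw [← Units.val_pow_eq_pow_val, ← map_pow]
  refine le_of_lt (hV (ht ⟨(key _ (hpow1 n) (hpow n)).1, (key (a ^ n)⁻¹ ?_ ?_).2⟩))
  · intro v
    rw [units_inv_apply, map_inv₀, hpow1, inv_one]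
  · intro v hv
    have h0 : ((a ^ n : (KAdele K)ˣ) : KAdele K) v ≠ 0 := fun h ↦ by
      have := hpow1 n v
      rw [h, map_zero] at this
      exact zero_ne_one this
    have : (((a ^ n : (KAdele K)ˣ) : KAdele K) v)⁻¹ - 1 =
      -((((a ^ n : (KAdele K)ˣ) : KAdele K) v - 1) / ((a ^ n : (KAdele K)ˣ) : KAdele K) v) := by
      field_simp
      ring
    rw [units_inv_apply, this, Valuation.map_neg, map_div₀, hpow1, div_one]
    exact hpow n v hv

theorem valuation_add_le_one_iff {F Γ : Type*} [Ring F] [LinearOrderedCommGroupWithZero Γ]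
    (v : Valuation F Γ) {x y : F} (hy : v y ≤ 1) : v (x + y) ≤ 1 ↔ v x ≤ 1 := by
  refine ⟨fun h ↦ ?_, fun h ↦ v.map_add_le h hy⟩
  rw [← add_sub_cancel_right x y]
  exact v.map_sub_le h hy

theorem localToFinite_apply_same (v : HeightOneSpectrum (𝓞 K)) (x : (v.adicCompletion K)ˣ) :
    (localToFinite v x : KAdele K) v = x := by
  classical
  exact Pi.mulSingle_eq_same (M := fun w : HeightOneSpectrum (𝓞 K) ↦ w.adicCompletion K) v _

theorem localToFinite_apply_of_ne {v w : HeightOneSpectrum (𝓞 K)} (h : w ≠ v)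
    (x : (v.adicCompletion K)ˣ) : (localToFinite v x : KAdele K) w = 1 := by
  classical
  exact Pi.mulSingle_eq_of_ne (M := fun w : HeightOneSpectrum (𝓞 K) ↦ w.adicCompletion K) h _

theorem component_localToFinite_same (v : HeightOneSpectrum (𝓞 K)) (x : (v.adicCompletion K)ˣ) :
    component v (localToFinite v x) = x :=
  Units.ext (localToFinite_apply_same v x)

theorem component_localToFinite_of_ne {v w : HeightOneSpectrum (𝓞 K)} (h : w ≠ v)
    (x : (v.adicCompletion K)ˣ) : component w (localToFinite v x) = 1 :=
  Units.ext (localToFinite_apply_of_ne h x)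

theorem exists_localComponent_eq_one (χ : HeckeCharacter K) :
    ∃ (S : Finset (HeightOneSpectrum (𝓞 K))) (ε : HeightOneSpectrum (𝓞 K) → ℤᵐ⁰),
      (∀ v, ε v ≠ 0) ∧ ∀ (v : HeightOneSpectrum (𝓞 K)) (x : (v.adicCompletion K)ˣ),
        Valued.v (x : v.adicCompletion K) = 1 →
        (v ∈ S → Valued.v ((x : v.adicCompletion K) - 1) < ε v) → χ.localComponent v x = 1 := by
  obtain ⟨S, ε, hε, h⟩ := exists_finitePart_eq_one χ
  refine ⟨S, ε, hε, fun v x hx hxS ↦ h _ (fun w ↦ ?_) fun w hw ↦ ?_⟩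
  · obtain rfl | hwv := eq_or_ne w v
    · rw [localToFinite_apply_same, hx]
    · rw [localToFinite_apply_of_ne hwv, map_one]
  · obtain rfl | hwv := eq_or_ne w v
    · rw [localToFinite_apply_same]
      exact hxS hw
    · rw [localToFinite_apply_of_ne hwv, sub_self, map_zero]
      exact zero_lt_iff.mpr (hε w)

theorem finite_ramified (χ : HeckeCharacter K) : {v | ¬ χ.IsUnramifiedAt v}.Finite := by
  obtain ⟨S, ε, hε, h⟩ := exists_localComponent_eq_one χ
  refine S.finite_toSet.subset fun v hv ↦ ?_
  by_contra hvS
  exact hv fun x hx ↦ h v x hx fun h ↦ absurd h hvS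

/-- On `∏ r_vˣ` a Hecke character is the product of its local components. -/
theorem finitePart_eq_finprod (χ : HeckeCharacter K) (e : (KAdele K)ˣ)
    (he : ∀ v, Valued.v ((e : KAdele K) v) = 1) :
    χ.finitePart e = ∏ᶠ v, χ.localComponent v (component v e) := by
  classical
  obtain ⟨S, ε, hε, h⟩ := exists_finitePart_eq_one χ
  have hc (T : Finset (HeightOneSpectrum (𝓞 K))) (w : HeightOneSpectrum (𝓞 K)) :
      component w (∏ v ∈ T, localToFinite v (component v e))
        = if w ∈ T then component w e else 1 := by
    rw [map_prod]
    split_ifs with hw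
    · rw [Finset.prod_eq_single w
        (fun v _ hvw ↦ component_localToFinite_of_ne hvw.symm _) (fun h ↦ absurd hw h),
        component_localToFinite_same]
    · exact Finset.prod_eq_one fun v hv ↦
        component_localToFinite_of_ne (fun h : w = v ↦ hw (h ▸ hv)) _
  have hs : Function.mulSupport (fun v ↦ χ.localComponent v (component v e)) ⊆ S := by
    intro v hv
    by_contra hvS
    refine hv (h _ (fun w ↦ ?_) fun w hw ↦ ?_)
    · obtain rfl | hwv := eq_or_ne w v
      · rw [localToFinite_apply_same, component_apply, he]
      · rw [localToFinite_apply_of_ne hwv, map_one]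
    · rw [localToFinite_apply_of_ne (fun h : w = v ↦ hvS (h ▸ hw)), sub_self, map_zero]
      exact zero_lt_iff.mpr (hε w)
  rw [finprod_eq_prod_of_mulSupport_subset _ hs]
  have h1 : χ.finitePart (e * (∏ v ∈ S, localToFinite v (component v e))⁻¹) = 1 := by
    refine h _ (fun w ↦ ?_) fun w hw ↦ ?_
    · rw [← component_apply, map_mul, map_inv, hc]
      split_ifs
      · simp
      · simp [he]
    · rw [← component_apply, map_mul, map_inv, hc, if_pos hw]
      simpa using zero_lt_iff.mpr (hε w)
  rw [map_mul, map_inv, mul_inv_eq_one] at h1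
  rw [h1, map_prod]
  rfl

/-! ### The standard function -/

namespace HeckeCharacter

variable (χ : HeckeCharacter K)

theorem localFunction_of_unramified {v : HeightOneSpectrum (𝓞 K)} (hv : χ.IsUnramifiedAt v)
    (x : v.adicCompletion K) [Decidable (Valued.v x ≤ 1)] :
    χ.localFunction v x = if Valued.v x ≤ 1 then 1 else 0 := by
  rw [localFunction, if_pos hv]
  simp only [HeightOneSpectrum.mem_adicCompletionIntegers]

theorem localFunction_of_ramified {v : HeightOneSpectrum (𝓞 K)} (hv : ¬ χ.IsUnramifiedAt v)
    (x : (v.adicCompletion K)ˣ) (hx : Valued.v (x : v.adicCompletion K) = 1) :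
    χ.localFunction v x = ((χ.localComponent v x)⁻¹ : ℂˣ) := by
  rw [localFunction, if_neg hv, dif_pos hx]
  congr 4
  exact Units.ext rfl

theorem localFunction_of_ramified_of_ne {v : HeightOneSpectrum (𝓞 K)}
    (hv : ¬ χ.IsUnramifiedAt v) {x : v.adicCompletion K} (hx : Valued.v x ≠ 1) :
    χ.localFunction v x = 0 := by
  rw [localFunction, if_neg hv, dif_neg hx]

theorem localFunction_eq_zero {v : HeightOneSpectrum (𝓞 K)} {x : v.adicCompletion K}
    (hx : ¬ Valued.v x ≤ 1) : χ.localFunction v x = 0 := by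
  classical
  by_cases hv : χ.IsUnramifiedAt v
  · rw [χ.localFunction_of_unramified hv, if_neg hx]
  · exact χ.localFunction_of_ramified_of_ne hv fun h ↦ hx h.le

theorem localFunction_unit_mul {v : HeightOneSpectrum (𝓞 K)} (e : (v.adicCompletion K)ˣ)
    (he : Valued.v (e : v.adicCompletion K) = 1) (x : v.adicCompletion K) :
    χ.localFunction v (e * x) = ((χ.localComponent v e)⁻¹ : ℂˣ) * χ.localFunction v x := by
  classical
  by_cases hv : χ.IsUnramifiedAt v
  · rw [χ.localFunction_of_unramified hv, χ.localFunction_of_unramified hv, hv e he, map_mul, he,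
      one_mul]
    simp
  · by_cases hx : Valued.v x = 1
    · have h0 : x ≠ 0 := fun h ↦ by simp [h] at hx
      have h1 := χ.localFunction_of_ramified hv (Units.mk0 x h0) hx
      have h2 := χ.localFunction_of_ramified hv (e * Units.mk0 x h0) (by simp [he, hx])
      rw [Units.val_mul, Units.val_mk0] at h2
      rw [Units.val_mk0] at h1
      rw [h1, h2, map_mul, mul_inv, Units.val_mul]
    · rw [χ.localFunction_of_ramified_of_ne hv hx, χ.localFunction_of_ramified_of_ne hv, mul_zero]
      rwa [map_mul, he, one_mul]

theorem exists_localFunction_add_eq :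
    ∃ δ : HeightOneSpectrum (𝓞 K) → ℤᵐ⁰, (∀ v, δ v ≠ 0) ∧
      ∀ (v : HeightOneSpectrum (𝓞 K)) (x y : v.adicCompletion K), Valued.v y < δ v →
        χ.localFunction v (x + y) = χ.localFunction v x := by
  classical
  obtain ⟨S, ε, hε, h⟩ := exists_localComponent_eq_one χ
  refine ⟨fun v ↦ min (ε v) 1, fun v ↦ (lt_min (zero_lt_iff.mpr (hε v)) one_pos).ne',
    fun v x y hy ↦ ?_⟩
  have hy1 : Valued.v y < 1 := hy.trans_le (min_le_right _ _)
  by_cases hv : χ.IsUnramifiedAt v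
  · rw [χ.localFunction_of_unramified hv, χ.localFunction_of_unramified hv]
    simp only [valuation_add_le_one_iff Valued.v hy1.le]
  · by_cases hx : Valued.v x = 1
    · have h0 : x ≠ 0 := fun h ↦ by simp [h] at hx
      have h1 : Valued.v (1 + y / x) = 1 := by
        rw [Valuation.map_one_add_of_lt]
        rwa [map_div₀, hx, div_one]
      have h2 : 1 + y / x ≠ 0 := fun h ↦ by simp [h] at h1
      obtain ⟨u, hu⟩ : ∃ u : (v.adicCompletion K)ˣ, (u : v.adicCompletion K) = 1 + y / x :=
        ⟨Units.mk0 _ h2, rfl⟩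
      have e : x + y = u * x := by
        rw [hu, add_mul, one_mul, div_mul_cancel₀ _ h0]
      have hu1 : Valued.v (u : v.adicCompletion K) = 1 := by rw [hu, h1]
      rw [e, χ.localFunction_unit_mul u hu1, h v u hu1, inv_one, Units.val_one, one_mul]
      intro _
      rw [hu, add_sub_cancel_left, map_div₀, hx, div_one]
      exact hy.trans_le (min_le_left _ _)
    · rw [χ.localFunction_of_ramified_of_ne hv hx, χ.localFunction_of_ramified_of_ne hv]
      intro hxy
      apply hx
      have := Valuation.map_sub_eq_of_lt_right (v := Valued.v) (x := y) (y := x + y)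
        (by rwa [hxy])
      rw [← hxy, ← this, Valuation.map_sub_swap, add_sub_cancel_right]

theorem finite_mulSupport_localFunction (x : KAdele K) :
    (Function.mulSupport fun v ↦ χ.localFunction v (x v)).Finite := by
  classical
  have h : ∀ᶠ v in Filter.cofinite, Valued.v (x v) ≤ 1 := x.2
  refine ((finite_ramified χ).union h).subset fun v hv ↦ ?_
  by_contra hn
  rw [Set.mem_union, not_or] at hn
  have h1 : χ.IsUnramifiedAt v := not_not.mp hn.1
  have h2 : Valued.v (x v) ≤ 1 := not_not.mp hn.2
  refine hv ?_
  simp only [χ.localFunction_of_unramified h1, if_pos h2]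

theorem standardFunction_eq_zero {x : KAdele K} {v : HeightOneSpectrum (𝓞 K)}
    (hx : ¬ Valued.v (x v) ≤ 1) : χ.standardFunction x = 0 :=
  finprod_eq_zero _ v (χ.localFunction_eq_zero hx) (χ.finite_mulSupport_localFunction x)

theorem standardFunction_congr {x y : KAdele K}
    (h : ∀ v, ¬ χ.IsUnramifiedAt v → x v = y v)
    (h' : ∀ v, χ.IsUnramifiedAt v → (Valued.v (x v) ≤ 1 ↔ Valued.v (y v) ≤ 1)) :
    χ.standardFunction x = χ.standardFunction y := by
  classical
  refine finprod_congr fun v ↦ ?_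
  by_cases hv : χ.IsUnramifiedAt v
  · rw [χ.localFunction_of_unramified hv, χ.localFunction_of_unramified hv]
    simp only [h' v hv]
  · rw [h v hv]

theorem finitePart_mul_standardFunction_unit_mul (e : (KAdele K)ˣ)
    (he : ∀ v, Valued.v ((e : KAdele K) v) = 1) (x : KAdele K) :
    (χ.finitePart e : ℂ) * χ.standardFunction (e * x) = χ.standardFunction x := by
  have hf : (Function.mulSupport fun v ↦ χ.localComponent v (component v e)).Finite :=
    (finite_ramified χ).subset fun v hv hu ↦ hv (hu _ (he v))
  have hf' : (Function.mulSupport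
      fun v ↦ (((χ.localComponent v (component v e))⁻¹ : ℂˣ) : ℂ)).Finite :=
    hf.subset fun v hv h1 ↦ hv (by simp [h1])
  have h1 : χ.standardFunction (e * x) =
      (∏ᶠ v, (((χ.localComponent v (component v e))⁻¹ : ℂˣ) : ℂ)) * χ.standardFunction x := by
    rw [standardFunction, standardFunction,
      ← finprod_mul_distrib hf' (χ.finite_mulSupport_localFunction x)]
    exact finprod_congr fun v ↦ χ.localFunction_unit_mul (component v e) (he v) _
  have h2 : (∏ᶠ v, (((χ.localComponent v (component v e))⁻¹ : ℂˣ) : ℂ)) =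
      ((χ.finitePart e)⁻¹ : ℂˣ) := by
    rw [finitePart_eq_finprod χ e he, ← finprod_inv_distrib]
    refine (MonoidHom.map_finprod (Units.coeHom ℂ) (?_ : (Function.mulSupport
      fun v ↦ (χ.localComponent v (component v e))⁻¹).Finite)).symm
    exact hf.subset fun v hv h1 ↦ hv (by simp [h1])
  rw [h1, h2, ← mul_assoc, ← Units.val_mul, mul_inv_cancel, Units.val_one, one_mul]

theorem isSchwartzBruhat_standardFunction : IsSchwartzBruhat χ.standardFunction := by
  constructor
  · obtain ⟨δ, hδ, h⟩ := χ.exists_localFunction_add_eq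
    set S := (finite_ramified χ).toFinset with hS
    rw [IsLocallyConstant.iff_eventually_eq]
    intro x
    have h0 : (⋂ v ∈ S, {y : KAdele K | Valued.v (y v) < δ v}) ∩ integralAdeles (𝓞 K) K ∈
        nhds (x - x) := by
      rw [sub_self]
      refine Filter.inter_mem ((Filter.biInter_finset_mem S).mpr fun v _ ↦ ?_)
        (isOpen_integralAdeles.mem_nhds fun v ↦ by simp)
      have hb : {y : v.adicCompletion K | Valued.v y < δ v} ∈ nhds ((0 : KAdele K) v) :=
        (mem_nhds_zero_iff_exists_ball v).mpr ⟨δ v, hδ v, fun _ h ↦ h⟩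
      exact (continuous_adele_eval v).continuousAt.preimage_mem_nhds hb
    filter_upwards [(continuous_id.sub continuous_const).continuousAt.preimage_mem_nhds h0]
      with y hy
    have hyS : ∀ v ∈ S, Valued.v (y v - x v) < δ v := by
      intro v hv
      exact Set.mem_iInter₂.mp hy.1 v hv
    classical
    refine finprod_congr fun v ↦ ?_
    by_cases hv : χ.IsUnramifiedAt v
    · have hyv : Valued.v (y v - x v) ≤ 1 := hy.2 v
      rw [χ.localFunction_of_unramified hv, χ.localFunction_of_unramified hv]
      have := valuation_add_le_one_iff Valued.v (x := x v) hyv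
      rw [add_sub_cancel] at this
      simp only [this]
    · have := h v (x v) (y v - x v) (hyS v (by simpa [hS] using hv))
      rwa [add_sub_cancel] at this
  · refine HasCompactSupport.intro (K := integralAdeles (𝓞 K) K) isCompact_integralAdeles ?_
    intro x hx
    simp only [integralAdeles, Set.mem_ofPred_eq, not_forall] at hx
    obtain ⟨v, hv⟩ := hx
    exact χ.standardFunction_eq_zero hv

end HeckeCharacter

/-! ### Functions attached to ideals and to the group ring -/

theorem ideleOf_mem (𝔞 : IdealGroup K) : ideleOf 𝔞 ∈ idelesOf 𝔞 := (idelesOf_nonempty 𝔞).some_mem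

theorem mul_mem_idelesOf {𝔞 𝔟 : IdealGroup K} {a b : (KAdele K)ˣ} (ha : a ∈ idelesOf 𝔞)
    (hb : b ∈ idelesOf 𝔟) : a * b ∈ idelesOf (𝔞 * 𝔟) := by
  intro v
  rw [Units.val_mul, adele_mul_apply, map_mul, ha v, hb v, ← WithZero.exp_add, Units.val_mul,
    FractionalIdeal.count_mul K v 𝔞.ne_zero 𝔟.ne_zero, neg_add]

theorem inv_mem_idelesOf {𝔞 : IdealGroup K} {a : (KAdele K)ˣ} (ha : a ∈ idelesOf 𝔞) :
    a⁻¹ ∈ idelesOf 𝔞⁻¹ := by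
  intro v
  rw [units_inv_apply, map_inv₀, ha v, ← WithZero.exp_neg, Units.val_inv_eq_inv_val,
    FractionalIdeal.count_inv]

/-- A uniformizer at `v`, namely the component at `v` of the chosen idele of `𝔭_v`, viewed as an
idele with component `1` at the other places. -/
def primeIdele (v : HeightOneSpectrum (𝓞 K)) : (KAdele K)ˣ :=
  localToFinite v (component v (ideleOf (primeIdeal v)))

theorem valued_primeIdele_same (v : HeightOneSpectrum (𝓞 K)) :
    Valued.v ((primeIdele v : KAdele K) v) = WithZero.exp (-1) := by
  rw [primeIdele, localToFinite_apply_same, component_apply, ideleOf_mem (primeIdeal v) v]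
  congr 2
  exact FractionalIdeal.count_self K v

theorem primeIdele_apply_of_ne {v w : HeightOneSpectrum (𝓞 K)} (h : w ≠ v) :
    (primeIdele v : KAdele K) w = 1 :=
  localToFinite_apply_of_ne h _

theorem primeIdele_mem (v : HeightOneSpectrum (𝓞 K)) : primeIdele v ∈ idelesOf (primeIdeal v) := by
  intro w
  obtain rfl | h := eq_or_ne w v
  · rw [valued_primeIdele_same]
    congr 2
    exact (FractionalIdeal.count_self K w).symm
  · rw [primeIdele_apply_of_ne h, map_one]
    have : FractionalIdeal.count K w (primeIdeal v : FractionalIdeal (𝓞 K)⁰ K) = 0 :=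
      FractionalIdeal.count_maximal_coprime K w h.symm
    rw [this, neg_zero, WithZero.exp_zero]

namespace HeckeCharacter

variable (χ : HeckeCharacter K)

theorem onIdeals_primeIdeal {v : HeightOneSpectrum (𝓞 K)} (hv : χ.IsUnramifiedAt v) :
    χ.onIdeals (primeIdeal v) = χ.finitePart (primeIdele v) := by
  classical
  rw [onIdeals, finprod_eq_single _ v, finprod_eq_if, if_pos hv]
  · rfl
  · intro w hw
    rw [finprod_eq_if]
    split_ifs with h
    · rw [h _, Units.val_one]
      rw [component_apply, ideleOf_mem (primeIdeal v) w]
      have : FractionalIdeal.count K w (primeIdeal v : FractionalIdeal (𝓞 K)⁰ K) = 0 :=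
        FractionalIdeal.count_maximal_coprime K w hw.symm
      rw [this, neg_zero, WithZero.exp_zero]
    · rfl

theorem idealFunction_eq {𝔟 : IdealGroup K} {b : (KAdele K)ˣ} (hb : b ∈ idelesOf 𝔟)
    (x : KAdele K) :
    χ.idealFunction 𝔟 x = (χ.finitePart b : ℂ) * χ.standardFunction (b * x) := by
  have h := χ.finitePart_mul_standardFunction_unit_mul (ideleOf 𝔟 * b⁻¹) (fun v ↦ by
    rw [Units.val_mul, adele_mul_apply, units_inv_apply, map_mul, map_inv₀, hb v,
      ideleOf_mem 𝔟 v, mul_inv_cancel₀ WithZero.exp_ne_zero]) ((b : KAdele K) * x)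
  rw [← mul_assoc, ← Units.val_mul, inv_mul_cancel_right] at h
  rw [← h, ← mul_assoc, ← Units.val_mul, ← map_mul, mul_comm b, inv_mul_cancel_right]
  rfl

theorem groupRingFunction_add (y z : MonoidAlgebra ℂ (IdealGroup K)) (x : KAdele K) :
    χ.groupRingFunction (y + z) x = χ.groupRingFunction y x + χ.groupRingFunction z x := by
  classical
  exact Finsupp.sum_add_index' (by simp) (by intros; ring)

theorem groupRingFunction_single (𝔟 : IdealGroup K) (c : ℂ) (x : KAdele K) :
    χ.groupRingFunction (MonoidAlgebra.single 𝔟 c) x = c * χ.idealFunction 𝔟 x :=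
  Finsupp.sum_single_index (zero_mul _)

theorem groupRingFunction_zero (x : KAdele K) : χ.groupRingFunction 0 x = 0 :=
  Finsupp.sum_zero_index

theorem groupRingFunction_sub (y z : MonoidAlgebra ℂ (IdealGroup K)) (x : KAdele K) :
    χ.groupRingFunction (y - z) x = χ.groupRingFunction y x - χ.groupRingFunction z x := by
  rw [eq_sub_iff_add_eq, ← groupRingFunction_add, sub_add_cancel]

theorem groupRingFunction_single_mul {𝔞 : IdealGroup K} {a : (KAdele K)ˣ} (ha : a ∈ idelesOf 𝔞)
    (c : ℂ) (z : MonoidAlgebra ℂ (IdealGroup K)) (x : KAdele K) :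
    χ.groupRingFunction (MonoidAlgebra.single 𝔞 c * z) x =
      c * χ.finitePart a * χ.groupRingFunction z (a * x) := by
  induction z using MonoidAlgebra.induction_linear with
  | zero => simp [groupRingFunction_zero]
  | add y z hy hz => rw [mul_add, groupRingFunction_add, groupRingFunction_add, hy, hz, mul_add]
  | single 𝔟 d =>
    rw [MonoidAlgebra.single_mul_single, groupRingFunction_single, groupRingFunction_single,
      χ.idealFunction_eq (mul_mem_idelesOf ha (ideleOf_mem 𝔟)),
      χ.idealFunction_eq (ideleOf_mem 𝔟), Units.val_mul,
      mul_comm (a : KAdele K) (ideleOf 𝔟 : KAdele K), mul_assoc (ideleOf 𝔟 : KAdele K), map_mul,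
      Units.val_mul]
    ring

/-- Multiplication of `z` by the smoothing element amounts to applying the two difference operators
`1 - N(𝔭) (π_𝔭⁻¹)^*` and `1 - (π_𝔮)^*` to `Φ_{χ,z}`. -/
theorem groupRingFunction_smoothing_mul {𝔭 𝔮 : HeightOneSpectrum (𝓞 K)}
    (h𝔭 : χ.IsUnramifiedAt 𝔭) (h𝔮 : χ.IsUnramifiedAt 𝔮) (z : MonoidAlgebra ℂ (IdealGroup K))
    (x : KAdele K) :
    χ.groupRingFunction (χ.smoothing 𝔭 𝔮 * z) x =
      χ.groupRingFunction z x - χ.groupRingFunction z (primeIdele 𝔮 * x)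
        - Ideal.absNorm 𝔭.asIdeal *
          (χ.groupRingFunction z (((primeIdele 𝔭)⁻¹ : (KAdele K)ˣ) * x)
            - χ.groupRingFunction z
              (primeIdele 𝔮 * (((primeIdele 𝔭)⁻¹ : (KAdele K)ˣ) * x))) := by
  have e1 (y : MonoidAlgebra ℂ (IdealGroup K)) (x : KAdele K) :
      χ.groupRingFunction (MonoidAlgebra.single (primeIdeal 𝔭)⁻¹
        ((Ideal.absNorm 𝔭.asIdeal : ℂ) * χ.onIdeals (primeIdeal 𝔭)) * y) x =
      Ideal.absNorm 𝔭.asIdeal *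
        χ.groupRingFunction y (((primeIdele 𝔭)⁻¹ : (KAdele K)ˣ) * x) := by
    have h1 : (χ.finitePart (primeIdele 𝔭) : ℂ) * χ.finitePart (primeIdele 𝔭)⁻¹ = 1 := by
      rw [← Units.val_mul, ← map_mul, mul_inv_cancel, map_one, Units.val_one]
    rw [χ.groupRingFunction_single_mul (inv_mem_idelesOf (primeIdele_mem 𝔭)),
      χ.onIdeals_primeIdeal h𝔭]
    linear_combination (Ideal.absNorm 𝔭.asIdeal : ℂ) *
      χ.groupRingFunction y (((primeIdele 𝔭)⁻¹ : (KAdele K)ˣ) * x) * h1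
  have e2 (y : MonoidAlgebra ℂ (IdealGroup K)) (x : KAdele K) :
      χ.groupRingFunction (MonoidAlgebra.single (primeIdeal 𝔮)
        (χ.onIdeals (primeIdeal 𝔮))⁻¹ * y) x = χ.groupRingFunction y (primeIdele 𝔮 * x) := by
    rw [χ.groupRingFunction_single_mul (primeIdele_mem 𝔮), χ.onIdeals_primeIdeal h𝔮,
      inv_mul_cancel₀ (Units.ne_zero _), one_mul]
  rw [smoothing, mul_assoc, sub_mul, one_mul, groupRingFunction_sub, e1, sub_mul, one_mul,
    groupRingFunction_sub, groupRingFunction_sub, e2, e2]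

end HeckeCharacter

theorem IsSchwartzBruhat.sub {Φ Ψ : KAdele K → ℂ} (hΦ : IsSchwartzBruhat Φ)
    (hΨ : IsSchwartzBruhat Ψ) : IsSchwartzBruhat fun x ↦ Φ x - Ψ x :=
  ⟨hΦ.1.sub hΨ.1, hΦ.2.sub hΨ.2⟩

theorem IsSchwartzBruhat.add {Φ Ψ : KAdele K → ℂ} (hΦ : IsSchwartzBruhat Φ)
    (hΨ : IsSchwartzBruhat Ψ) : IsSchwartzBruhat fun x ↦ Φ x + Ψ x :=
  ⟨hΦ.1.add hΨ.1, hΦ.2.add hΨ.2⟩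

theorem IsSchwartzBruhat.const_mul {Φ : KAdele K → ℂ} (hΦ : IsSchwartzBruhat Φ) (c : ℂ) :
    IsSchwartzBruhat fun x ↦ c * Φ x :=
  ⟨hΦ.1.comp (c * ·), hΦ.2.mul_left⟩

theorem IsSchwartzBruhat.comp_unit_mul {Φ : KAdele K → ℂ} (hΦ : IsSchwartzBruhat Φ)
    (a : (KAdele K)ˣ) : IsSchwartzBruhat fun x : KAdele K ↦ Φ (a * x) :=
  ⟨hΦ.1.comp_continuous (continuous_const.mul continuous_id),
    hΦ.2.comp_homeomorph
      { toEquiv := a.mulLeft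
        continuous_toFun := continuous_const.mul continuous_id
        continuous_invFun := continuous_const.mul continuous_id }⟩

theorem isSchwartzBruhat_groupRingFunction (χ : HeckeCharacter K)
    (z : MonoidAlgebra ℂ (IdealGroup K)) : IsSchwartzBruhat (χ.groupRingFunction z) := by
  induction z using MonoidAlgebra.induction_linear with
  | zero =>
    have : χ.groupRingFunction 0 = fun _ ↦ 0 := funext χ.groupRingFunction_zero
    rw [this]
    exact ⟨IsLocallyConstant.const 0, HasCompactSupport.zero⟩
  | add y z hy hz =>
    rw [funext (χ.groupRingFunction_add y z)]
    exact hy.add hz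
  | single 𝔟 c =>
    rw [funext (χ.groupRingFunction_single 𝔟 c)]
    exact ((χ.isSchwartzBruhat_standardFunction.comp_unit_mul _).const_mul _).const_mul _

/-- `Φ` is, outside a finite set `S` of places, a function of the indicator functions of the
`r_v`, and it is supported on the adeles that are integral outside `S`. -/
structure IsUnramifiedOutside (Φ : KAdele K → ℂ) (S : Set (HeightOneSpectrum (𝓞 K))) : Prop where
  integral : ∀ {x}, Φ x ≠ 0 → ∀ v ∉ S, Valued.v (x v) ≤ 1
  congr : ∀ {x y : KAdele K}, (∀ v ∈ S, x v = y v) →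
    (∀ v ∉ S, Valued.v (x v) ≤ 1 ↔ Valued.v (y v) ≤ 1) → Φ x = Φ y

namespace IsUnramifiedOutside

variable {Φ Ψ : KAdele K → ℂ} {S T : Set (HeightOneSpectrum (𝓞 K))}

theorem mono (h : IsUnramifiedOutside Φ S) (hST : S ⊆ T) : IsUnramifiedOutside Φ T where
  integral hx v hv := h.integral hx v fun hS ↦ hv (hST hS)
  congr hx hx' := h.congr (fun v hv ↦ hx v (hST hv)) fun v _ ↦ by
    by_cases hT : v ∈ T
    · rw [hx v hT]
    · exact hx' v hT

theorem add (h : IsUnramifiedOutside Φ S) (h' : IsUnramifiedOutside Ψ S) :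
    IsUnramifiedOutside (fun x ↦ Φ x + Ψ x) S where
  integral {x} hx v hv := by
    by_cases h0 : Φ x = 0
    · exact h'.integral (fun h1 ↦ hx (by simp [h0, h1])) v hv
    · exact h.integral h0 v hv
  congr hx hx' := by rw [h.congr hx hx', h'.congr hx hx']

theorem const_mul (h : IsUnramifiedOutside Φ S) (c : ℂ) :
    IsUnramifiedOutside (fun x ↦ c * Φ x) S where
  integral hx := h.integral (right_ne_zero_of_mul hx)
  congr hx hx' := by rw [h.congr hx hx']

theorem sub (h : IsUnramifiedOutside Φ S) (h' : IsUnramifiedOutside Ψ S) :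
    IsUnramifiedOutside (fun x ↦ Φ x - Ψ x) S := by
  simpa [sub_eq_add_neg] using h.add (h'.const_mul (-1))

theorem comp_unit_mul (h : IsUnramifiedOutside Φ S) (a : (KAdele K)ˣ)
    (ha : ∀ v ∉ S, Valued.v ((a : KAdele K) v) = 1) :
    IsUnramifiedOutside (fun x : KAdele K ↦ Φ (a * x)) S where
  integral hx v hv := by
    have := h.integral hx v hv
    rwa [adele_mul_apply, map_mul, ha v hv, one_mul] at this
  congr hx hx' := h.congr (fun v hv ↦ by simp [hx v hv]) fun v hv ↦ by
    simpa [ha v hv] using hx' v hv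

end IsUnramifiedOutside

theorem exists_isUnramifiedOutside_groupRingFunction (χ : HeckeCharacter K)
    (z : MonoidAlgebra ℂ (IdealGroup K)) :
    ∃ S : Set (HeightOneSpectrum (𝓞 K)), S.Finite ∧
      IsUnramifiedOutside (χ.groupRingFunction z) S := by
  induction z using MonoidAlgebra.induction_linear with
  | zero =>
    refine ⟨∅, Set.finite_empty, ?_⟩
    rw [funext χ.groupRingFunction_zero]
    exact ⟨fun h ↦ absurd rfl h, fun _ _ ↦ rfl⟩
  | add y z hy hz =>
    obtain ⟨S, hS, hy⟩ := hy
    obtain ⟨T, hT, hz⟩ := hz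
    rw [funext (χ.groupRingFunction_add y z)]
    exact ⟨S ∪ T, hS.union hT,
      (hy.mono Set.subset_union_left).add (hz.mono Set.subset_union_right)⟩
  | single 𝔟 c =>
    have hb : ∀ᶠ v in Filter.cofinite, Valued.v ((ideleOf 𝔟 : KAdele K) v) = 1 :=
      (FiniteAdeleRing.isUnit_iff.mp (ideleOf 𝔟).isUnit).2
    have h0 : IsUnramifiedOutside χ.standardFunction {v | ¬ χ.IsUnramifiedAt v} :=
      ⟨fun hx v _ ↦ not_not.mp fun h ↦ hx (χ.standardFunction_eq_zero h),
        fun hx hx' ↦ χ.standardFunction_congr hx fun v hv ↦ hx' v (not_not.mpr hv)⟩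
    refine ⟨_, (finite_ramified χ).union hb, ?_⟩
    rw [funext (χ.groupRingFunction_single 𝔟 c)]
    refine (((h0.mono Set.subset_union_left).comp_unit_mul _
      fun v hv ↦ ?_).const_mul _).const_mul _
    exact not_not.mp fun h ↦ hv (Or.inr h)

/-! ### Primes of degree one -/

theorem intCast_mem_below {L : Type*} [Field L] (v : HeightOneSpectrum (𝓞 L)) (m : ℤ) :
    m ∈ (below v).asIdeal ↔ (m : 𝓞 L) ∈ v.asIdeal := by
  change algebraMap ℤ (𝓞 L) m ∈ v.asIdeal ↔ _
  rw [eq_intCast]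

theorem absNorm_mem_below (v : HeightOneSpectrum (𝓞 K)) :
    (Ideal.absNorm v.asIdeal : ℤ) ∈ (below v).asIdeal := by
  rw [intCast_mem_below, Int.cast_natCast]
  exact Ideal.absNorm_mem _

theorem dvd_of_mem_of_mem {R : Type*} [CommRing R] {P : Ideal R} (hP : P ≠ ⊤) {p : ℕ}
    (hp : p.Prime) (hpP : (p : R) ∈ P) {m : ℤ} (hm : (m : R) ∈ P) : (p : ℤ) ∣ m := by
  by_contra h
  obtain ⟨a, b, hab⟩ := ((Nat.prime_iff_prime_int.mp hp).coprime_iff_not_dvd.mpr h)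
  refine hP (P.eq_top_iff_one.mpr ?_)
  have : (1 : R) = (a : R) * (p : R) + (b : R) * (m : R) := by
    exact_mod_cast (congrArg (Int.cast : ℤ → R) hab).symm
  rw [this]
  exact P.add_mem (P.mul_mem_left _ hpP) (P.mul_mem_left _ hm)

theorem below_eq_of_mem {p : ℕ} (hp : p.Prime) {u u' : HeightOneSpectrum ℤ}
    (hu : (p : ℤ) ∈ u.asIdeal) (hu' : (p : ℤ) ∈ u'.asIdeal) : u = u' := by
  have h : ∀ u : HeightOneSpectrum ℤ, (p : ℤ) ∈ u.asIdeal → u.asIdeal = Ideal.span {(p : ℤ)} := by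
    intro u hu
    refine le_antisymm (fun m hm ↦ ?_) ((Ideal.span_singleton_le_iff_mem _).mpr hu)
    exact Ideal.mem_span_singleton.mpr
      (dvd_of_mem_of_mem u.isPrime.ne_top hp (by exact_mod_cast hu) (by exact_mod_cast hm))
  exact HeightOneSpectrum.ext ((h u hu).trans (h u' hu').symm)

/-- The rational primes below the places in a finite set. -/
def primesBelow (S : Finset (HeightOneSpectrum (𝓞 K))) : Finset ℕ :=
  S.biUnion fun v ↦ (Ideal.absNorm v.asIdeal).primeFactors

theorem prime_of_mem_primesBelow {S : Finset (HeightOneSpectrum (𝓞 K))} {p : ℕ}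
    (hp : p ∈ primesBelow S) : p.Prime := by
  obtain ⟨v, -, hv⟩ := Finset.mem_biUnion.mp hp
  exact Nat.prime_of_mem_primeFactors hv

theorem notMem_of_notMem_primesBelow {S : Finset (HeightOneSpectrum (𝓞 K))}
    {v w : HeightOneSpectrum (𝓞 K)} (hv : (Ideal.absNorm v.asIdeal).Prime)
    (hvS : Ideal.absNorm v.asIdeal ∉ primesBelow S) (hw : below w = below v) : w ∉ S := by
  intro hwS
  refine hvS (Finset.mem_biUnion.mpr ⟨w, hwS, ?_⟩)
  have h1 := absNorm_mem_below v
  rw [← hw, intCast_mem_below, Int.cast_natCast] at h1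
  have h2 := dvd_of_mem_of_mem w.isPrime.ne_top hv h1 (m := Ideal.absNorm w.asIdeal)
    (by rw [Int.cast_natCast]; exact Ideal.absNorm_mem _)
  exact Nat.mem_primeFactors.mpr ⟨hv, Int.natCast_dvd_natCast.mp h2,
    (Ideal.absNorm_ne_zero_iff_mem_nonZeroDivisors.mpr (mem_nonZeroDivisors_of_ne_zero w.ne_bot))⟩

theorem below_ne_of_absNorm_ne {v w : HeightOneSpectrum (𝓞 K)}
    (hv : (Ideal.absNorm v.asIdeal).Prime) (hw : (Ideal.absNorm w.asIdeal).Prime)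
    (h : Ideal.absNorm v.asIdeal ≠ Ideal.absNorm w.asIdeal) : below v ≠ below w := by
  intro he
  have h1 := absNorm_mem_below v
  rw [he] at h1
  have := dvd_of_mem_of_mem (below w).isPrime.ne_top hw (by exact_mod_cast absNorm_mem_below w)
    (by exact_mod_cast h1)
  exact h ((Nat.prime_dvd_prime_iff_eq hw hv).mp (Int.natCast_dvd_natCast.mp this)).symm

theorem valuation_intCast_le_one (v : HeightOneSpectrum (𝓞 K)) (m : ℤ) :
    v.valuation K (m : K) ≤ 1 := by
  simpa using v.valuation_le_one (K := K) (m : 𝓞 K)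

theorem valuation_intCast_eq_one {v w : HeightOneSpectrum (𝓞 K)}
    (hv : (Ideal.absNorm v.asIdeal).Prime) (hw : below w = below v) {m : ℤ}
    (hm : ¬ (Ideal.absNorm v.asIdeal : ℤ) ∣ m) : w.valuation K (m : K) = 1 := by
  have : (m : 𝓞 K) ∉ w.asIdeal := by
    rw [← intCast_mem_below, hw]
    intro h
    exact hm (dvd_of_mem_of_mem (below v).isPrime.ne_top hv
      (by exact_mod_cast absNorm_mem_below v) (by exact_mod_cast h))
  simpa using (w.valuation_eq_one_iff_notMem (K := K)).mpr this

theorem valuation_absNorm_eq_one {v w : HeightOneSpectrum (𝓞 K)}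
    (hv : (Ideal.absNorm v.asIdeal).Prime) (hw : below w ≠ below v) :
    w.valuation K (Ideal.absNorm v.asIdeal : K) = 1 := by
  have : ((Ideal.absNorm v.asIdeal : ℕ) : 𝓞 K) ∉ w.asIdeal := by
    intro h
    rw [← Int.cast_natCast, ← intCast_mem_below] at h
    exact hw (below_eq_of_mem hv h (absNorm_mem_below v))
  simpa using (w.valuation_eq_one_iff_notMem (K := K)).mpr this

theorem eq_of_natCast_sub_natCast_mem {v : HeightOneSpectrum (𝓞 K)}
    (hv : (Ideal.absNorm v.asIdeal).Prime) {a b : ℕ} (ha : a < Ideal.absNorm v.asIdeal)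
    (hb : b < Ideal.absNorm v.asIdeal) (h : (a : 𝓞 K) - (b : 𝓞 K) ∈ v.asIdeal) : a = b := by
  have h1 := dvd_of_mem_of_mem v.isPrime.ne_top hv (Ideal.absNorm_mem _) (m := (a : ℤ) - b)
    (by push_cast; exact h)
  obtain ⟨c, hc⟩ := h1
  have hc0 : c = 0 := by
    by_contra hc0
    rcases lt_or_gt_of_ne hc0 with h | h <;> nlinarith
  rw [hc0, mul_zero] at hc
  omega

theorem exists_natCast_sub_mem {v : HeightOneSpectrum (𝓞 K)}
    (hv : (Ideal.absNorm v.asIdeal).Prime) (s : 𝓞 K) :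
    ∃ b < Ideal.absNorm v.asIdeal, s - (b : 𝓞 K) ∈ v.asIdeal := by
  have hcard : Nat.card (𝓞 K ⧸ v.asIdeal) = Ideal.absNorm v.asIdeal := rfl
  have hfin : Finite (𝓞 K ⧸ v.asIdeal) := Nat.finite_of_card_ne_zero (hcard ▸ hv.ne_zero)
  have : Fintype (𝓞 K ⧸ v.asIdeal) := Fintype.ofFinite _
  let f : Fin (Ideal.absNorm v.asIdeal) → 𝓞 K ⧸ v.asIdeal := fun a ↦
    Ideal.Quotient.mk _ ((a : ℕ) : 𝓞 K)
  have hf : Function.Bijective f := by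
    rw [Fintype.bijective_iff_injective_and_card]
    refine ⟨fun a b hab ↦ Fin.ext (eq_of_natCast_sub_natCast_mem hv a.2 b.2
      (Ideal.Quotient.eq.mp hab)), ?_⟩
    rw [Fintype.card_fin, ← hcard, Nat.card_eq_fintype_card]
  obtain ⟨b, hb⟩ := hf.2 (Ideal.Quotient.mk _ s)
  exact ⟨b, b.2, Ideal.Quotient.eq.mp hb.symm⟩

/-- Since the residue field of a place of degree one is the prime field, exactly one of the
translates of `y` by the first `N(𝔭)` multiples of a unit `u` is divisible by `𝔭`. -/
theorem exists_valued_add_mul_lt_one_iff {v : HeightOneSpectrum (𝓞 K)}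
    (hv : (Ideal.absNorm v.asIdeal).Prime) {y u : v.adicCompletion K} (hy : Valued.v y ≤ 1)
    (hu : Valued.v u = 1) :
    ∃ b < Ideal.absNorm v.asIdeal, ∀ a < Ideal.absNorm v.asIdeal,
      Valued.v (y + a * u) < 1 ↔ a = b := by
  have hu0 : u ≠ 0 := fun h ↦ by simp [h] at hu
  obtain ⟨s, hs⟩ := exists_integer_sub_lt v (x := -(y / u))
    (by rw [Valuation.map_neg, map_div₀, hu, div_one]; exact hy) one_ne_zero
  obtain ⟨b, hb, hsb⟩ := exists_natCast_sub_mem hv s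
  refine ⟨b, hb, fun a ha ↦ ?_⟩
  have hcast : ∀ t : 𝓞 K, Valued.v ((t : K) : v.adicCompletion K) < 1 ↔ t ∈ v.asIdeal := by
    intro t
    rw [HeightOneSpectrum.valuedAdicCompletion_eq_valuation']
    exact v.valuation_lt_one_iff_mem t
  have e : y + a * u = u * (((((a : 𝓞 K) - s : 𝓞 K) : K) : v.adicCompletion K)
      - (-(y / u) - ((s : K) : v.adicCompletion K))) := by
    have : ((((a : 𝓞 K) - s : 𝓞 K) : K) : v.adicCompletion K)
        = (a : v.adicCompletion K) - ((s : K) : v.adicCompletion K) := by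
      change algebraMap K (v.adicCompletion K) (algebraMap (𝓞 K) K ((a : 𝓞 K) - s)) = _
      rw [map_sub, map_sub, map_natCast, map_natCast]
      rfl
    rw [this]
    have h2 : u * (y / u) = y := mul_div_cancel₀ y hu0
    linear_combination -h2
  have h1 : Valued.v (y + a * u) < 1 ↔ (a : 𝓞 K) - s ∈ v.asIdeal := by
    rw [e, map_mul, hu, one_mul, ← hcast]
    constructor
    · intro h
      have := Valuation.map_add_lt Valued.v h hs
      rwa [sub_add_cancel] at this
    · intro h
      exact Valuation.map_sub_lt Valued.v h hs
  rw [h1]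
  constructor
  · intro h
    refine eq_of_natCast_sub_natCast_mem hv ha hb ?_
    have := v.asIdeal.add_mem h hsb
    rwa [sub_add_sub_cancel] at this
  · rintro rfl
    rw [← neg_sub]
    exact v.asIdeal.neg_mem hsb

/-! ### Linear functionals at a prime of degree one -/

/-- For almost all primes `q`, a functional `K → ℚ` maps elements that are integral above `q` to
rationals that are integral at `q`; here `q` is the norm of a place of degree one. -/
theorem exists_valuation_functional_le_one (l : K →ₗ[ℚ] ℚ) :
    ∃ S : Finset (HeightOneSpectrum (𝓞 K)), ∀ v : HeightOneSpectrum (𝓞 K),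
      (Ideal.absNorm v.asIdeal).Prime → Ideal.absNorm v.asIdeal ∉ primesBelow S →
      ∀ t : K, (∀ w : HeightOneSpectrum (𝓞 K), below w = below v → w.valuation K t ≤ 1) →
      ∀ w : HeightOneSpectrum (𝓞 K), below w = below v →
        w.valuation K ((l t : ℚ) : K) ≤ 1 := by
  classical
  let ω := RingOfIntegers.basis K
  have hfin (x : K) : {v : HeightOneSpectrum (𝓞 K) | 1 < v.valuation K x}.Finite :=
    HeightOneSpectrum.Support.finite (𝓞 K) x
  refine ⟨Finset.univ.biUnion fun i ↦ (hfin ((l (ω i : K) : ℚ) : K)).toFinset, ?_⟩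
  intro v hv hvS t ht w hw
  set q := Ideal.absNorm v.asIdeal with hq
  obtain ⟨m, hm0, hm⟩ := ((IsFractionRing.isAlgebraic_iff ℤ ℚ K).mpr
    (Algebra.IsAlgebraic.isAlgebraic t)).exists_integral_multiple
  obtain ⟨c, hc, hqc⟩ := (Int.finiteMultiplicity_iff (a := (q : ℤ)).mpr
    ⟨by simpa using hv.ne_one, hm0⟩).exists_eq_pow_mul_and_not_dvd
  -- The prime-to-`q` part `c` of a denominator of `t` is already a denominator.
  obtain ⟨a, ha⟩ : ∃ a : 𝓞 K, (a : K) = c * t := by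
    refine HeightOneSpectrum.mem_integers_of_valuation_le_one K _ fun w ↦ ?_
    by_cases hw : below w = below v
    · rw [map_mul]
      exact mul_le_one₀ (valuation_intCast_le_one w c) zero_le (ht w hw)
    · have h1 : w.valuation K (m * t) ≤ 1 := by
        have : w.valuation K (m • t) ≤ 1 := w.valuation_le_one (K := K) (⟨m • t, hm⟩ : 𝓞 K)
        rwa [zsmul_eq_mul] at this
      rw [hc, Int.cast_mul, Int.cast_pow, Int.cast_natCast, mul_assoc, map_mul, map_pow,
        valuation_absNorm_eq_one hv hw, one_pow, one_mul] at h1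
      exact h1
  have hla : ((l a : ℚ) : K) = ∑ i, ((ω.repr a i : ℤ) : K) * ((l (ω i : K) : ℚ) : K) := by
    have h1 : (a : K) = ∑ i, (ω.repr a i : ℤ) • (ω i : K) := by
      conv_lhs => rw [← ω.sum_repr a]
      exact (map_sum (algebraMap (𝓞 K) K) _ _).trans
        (Finset.sum_congr rfl fun i _ ↦ map_zsmul (algebraMap (𝓞 K) K) _ _)
    rw [h1, map_sum, Rat.cast_sum]
    refine Finset.sum_congr rfl fun i _ ↦ ?_
    rw [map_zsmul, zsmul_eq_mul, Rat.cast_mul, Rat.cast_intCast]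
  have h2 : w.valuation K ((l a : ℚ) : K) ≤ 1 := by
    rw [hla]
    refine Valuation.map_sum_le _ fun i _ ↦ ?_
    rw [map_mul]
    refine mul_le_one₀ (valuation_intCast_le_one w _) zero_le (not_lt.mp fun h ↦ ?_)
    refine notMem_of_notMem_primesBelow hv hvS hw
      (Finset.mem_biUnion.mpr ⟨i, Finset.mem_univ i, ?_⟩)
    exact (hfin _).mem_toFinset.mpr h
  rw [ha, ← zsmul_eq_mul, map_zsmul, zsmul_eq_mul, Rat.cast_mul, Rat.cast_intCast, map_mul,
    valuation_intCast_eq_one hv hw hqc, one_mul] at h2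
  exact h2

/-- Duality with respect to the nondegenerate form `(x, y) ↦ l (x y)`. -/
theorem exists_eq_sum_functional_mul (l : K →ₗ[ℚ] ℚ) (hl : l ≠ 0) :
    ∃ e : Module.Free.ChooseBasisIndex ℤ (𝓞 K) → K, ∀ y : K,
      y = ∑ i, ((l (y * RingOfIntegers.basis K i) : ℚ) : K) * e i := by
  classical
  let B : LinearMap.BilinForm ℚ K := (LinearMap.mul ℚ K).compr₂ l
  have hB : B.Nondegenerate := by
    have hsep : ∀ x : K, (∀ y, l (x * y) = 0) → x = 0 := by
      intro x hx
      by_contra hx0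
      refine hl (LinearMap.ext fun y ↦ ?_)
      have := hx (x⁻¹ * y)
      rwa [mul_inv_cancel_left₀ hx0] at this
    exact ⟨hsep, fun y hy ↦ hsep y fun x ↦ by rw [mul_comm]; exact hy x⟩
  refine ⟨fun i ↦ B.dualBasis hB (integralBasis K) i, fun y ↦ ?_⟩
  conv_lhs => rw [← (B.dualBasis hB (integralBasis K)).sum_repr y]
  refine Finset.sum_congr rfl fun i _ ↦ ?_
  rw [LinearMap.BilinForm.dualBasis_repr_apply, Algebra.smul_def, eq_ratCast, integralBasis_apply]
  rfl

/-- Suppose that `y` has a simple pole at a place `𝔮` of degree one and is integral at the other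
places above the same rational prime `q`. Every `s ∈ 𝓞 K` is congruent modulo `𝔮` to some `b ∈ ℤ`,
and then `y (s - b)` is integral above `q`; so if `l y = 0`, then `l (y s)` is integral at `q` for
all `s`, which by duality forces `y` to be integral. -/
theorem exists_functional_ne_zero (l : K →ₗ[ℚ] ℚ) (hl : l ≠ 0) :
    ∃ S : Finset (HeightOneSpectrum (𝓞 K)), ∀ v : HeightOneSpectrum (𝓞 K),
      (Ideal.absNorm v.asIdeal).Prime → Ideal.absNorm v.asIdeal ∉ primesBelow S →
      ∀ y : K, (∀ w : HeightOneSpectrum (𝓞 K), below w = below v → w ≠ v → w.valuation K y ≤ 1) →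
      1 < v.valuation K y → v.valuation K y ≤ WithZero.exp 1 → l y ≠ 0 := by
  classical
  obtain ⟨S, hS⟩ := exists_valuation_functional_le_one l
  obtain ⟨e, he⟩ := exists_eq_sum_functional_mul l hl
  have hfin (x : K) : {v : HeightOneSpectrum (𝓞 K) | 1 < v.valuation K x}.Finite :=
    HeightOneSpectrum.Support.finite (𝓞 K) x
  refine ⟨S ∪ Finset.univ.biUnion fun i ↦ (hfin (e i)).toFinset, ?_⟩
  intro v hv hvS y hyw hy1 hyv hly
  have hvS1 : Ideal.absNorm v.asIdeal ∉ primesBelow S := fun h ↦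
    hvS (Finset.biUnion_subset_biUnion_of_subset_left _ Finset.subset_union_left h)
  refine hy1.not_ge ?_
  rw [he y]
  refine Valuation.map_sum_le _ fun i _ ↦ ?_
  rw [map_mul]
  refine mul_le_one₀ ?_ zero_le (not_lt.mp fun h ↦ notMem_of_notMem_primesBelow hv hvS rfl
    (Finset.mem_union_right _ (Finset.mem_biUnion.mpr
      ⟨i, Finset.mem_univ i, (hfin _).mem_toFinset.mpr h⟩)))
  set s := RingOfIntegers.basis K i
  obtain ⟨b, -, hb⟩ := exists_natCast_sub_mem hv s
  have e1 : l (y * s) = l (y * ((s - (b : 𝓞 K) : 𝓞 K) : K)) := by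
    have : y * (s : K) = y * ((s - (b : 𝓞 K) : 𝓞 K) : K) + (b : ℚ) • y := by
      have h1 : ((s - (b : 𝓞 K) : 𝓞 K) : K) = s - b := by
        change algebraMap (𝓞 K) K _ = _
        rw [map_sub, map_natCast]
      rw [Algebra.smul_def, map_natCast, h1]
      ring
    rw [this, map_add, map_smul, hly, smul_zero, add_zero]
  rw [e1]
  refine hS v hv hvS1 _ (fun w hw ↦ ?_) v rfl
  rw [map_mul]
  by_cases hwv : w = v
  · subst hwv
    have h1 : w.valuation K ((s - (b : 𝓞 K) : 𝓞 K) : K) ≤ WithZero.exp (-1) := by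
      rw [HeightOneSpectrum.valuation_of_algebraMap]
      have := (w.intValuation_le_pow_iff_mem (s - (b : 𝓞 K)) 1).mpr (by rwa [pow_one])
      simpa using this
    calc _ ≤ WithZero.exp (1 : ℤ) * WithZero.exp (-1) := mul_le_mul' hyv h1
      _ = 1 := by rw [← WithZero.exp_add]; simp
  · exact mul_le_one₀ (hyw w hw hwv) zero_le (w.valuation_le_one _)

/-! ### The map from the adeles of `ℚ` -/

theorem coe_eq_ratCast (v : HeightOneSpectrum (𝓞 K)) (r : ℚ) :
    ((r : K) : v.adicCompletion K) = (r : v.adicCompletion K) := by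
  have : algebraMap K (v.adicCompletion K) r = r := map_ratCast _ _
  exact this

theorem valued_ratCast (v : HeightOneSpectrum (𝓞 K)) (r : ℚ) :
    Valued.v (r : v.adicCompletion K) = v.valuation K (r : K) := by
  rw [← coe_eq_ratCast, HeightOneSpectrum.valuedAdicCompletion_eq_valuation']

theorem rat_valued_ratCast (u : HeightOneSpectrum ℤ) (r : ℚ) :
    Valued.v (r : u.adicCompletion ℚ) = u.valuation ℚ r := by
  rw [← eq_ratCast (algebraMap ℚ (u.adicCompletion ℚ))]
  exact HeightOneSpectrum.valuedAdicCompletion_eq_valuation' u r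

theorem baseChange_apply (x : QAdele) (v : HeightOneSpectrum (𝓞 K)) :
    (baseChange x : KAdele K) v = localMap v (x (below v)) := rfl

theorem continuous_localMap (v : HeightOneSpectrum (𝓞 K)) : Continuous (localMap v) :=
  (HeightOneSpectrum.adicCompletion.continuous_ofCompletion K v).comp
    (Completion.continuous_map.comp
      (HeightOneSpectrum.adicCompletion.continuous_toCompletion ℚ (below v)))

theorem continuous_baseChange : Continuous (baseChange : QAdele → KAdele K) :=
  RestrictedProduct.mapAlong_continuous (fun u : HeightOneSpectrum ℤ ↦ u.adicCompletion ℚ)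
    (fun v : HeightOneSpectrum (𝓞 K) ↦ v.adicCompletion K) below tendsto_below
    (fun v ↦ localMap v) (.of_forall localMap_mapsTo) continuous_localMap

theorem lt_one_iff_le_exp_neg_one (x : ℤᵐ⁰) : x < 1 ↔ x ≤ WithZero.exp (-1) := by
  have := WithZero.lt_mul_exp_iff_le (x := x) (y := WithZero.exp (-1)) WithZero.exp_ne_zero
  rwa [← WithZero.exp_add] at this

/-- The inclusion `ℚ_p → K_v` reflects integrality: an element of `ℚ_p` that is not integral has an
inverse divisible by a uniformizer `π`, whose image in `K_v` is not a unit. -/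
theorem valued_le_one_of_localMap (v : HeightOneSpectrum (𝓞 K)) {t : (below v).adicCompletion ℚ}
    (h : Valued.v (localMap v t) ≤ 1) : Valued.v t ≤ 1 := by
  by_contra ht
  rw [not_le] at ht
  have ht0 : t ≠ 0 := fun h ↦ by simp [h] at ht
  obtain ⟨π, hπ⟩ := (below v).intValuation_exists_uniformizer
  have hπv : Valued.v ((π : ℚ) : (below v).adicCompletion ℚ) = WithZero.exp (-1) := by
    rw [rat_valued_ratCast, ← hπ]
    exact (below v).valuation_of_algebraMap π
  have hπ0 : ((π : ℚ) : (below v).adicCompletion ℚ) ≠ 0 := fun h ↦ by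
    rw [h, map_zero] at hπv
    exact WithZero.exp_ne_zero hπv.symm
  have hπw : Valued.v (localMap v ((π : ℚ) : (below v).adicCompletion ℚ)) < 1 := by
    rw [map_ratCast, valued_ratCast]
    have : π ∈ (below v).asIdeal := by
      rw [← HeightOneSpectrum.intValuation_lt_one_iff_mem, hπ, lt_one_iff_le_exp_neg_one]
    rw [intCast_mem_below] at this
    simpa using (v.valuation_lt_one_iff_mem (K := K) _).mpr this
  have h1 : Valued.v (localMap v (t⁻¹ / ((π : ℚ) : (below v).adicCompletion ℚ))) ≤ 1 := by
    refine localMap_mapsTo v ((HeightOneSpectrum.mem_adicCompletionIntegers ℤ ℚ _).mpr ?_)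
    have h2 : Valued.v t⁻¹ ≤ WithZero.exp (-1) := by
      rw [← lt_one_iff_le_exp_neg_one, map_inv₀]
      exact inv_lt_one_of_one_lt₀ ht
    rw [map_div₀, hπv]
    exact div_le_one_of_le₀ h2 zero_le
  have h3 : (1 : v.adicCompletion K) = localMap v (t⁻¹ / ((π : ℚ) : (below v).adicCompletion ℚ)) *
      localMap v t * localMap v ((π : ℚ) : (below v).adicCompletion ℚ) := by
    rw [← map_mul, ← map_mul, mul_right_comm, div_mul_cancel₀ _ hπ0, inv_mul_cancel₀ ht0, map_one]
  have h4 : Valued.v (1 : v.adicCompletion K) < 1 := by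
    rw [h3, map_mul, map_mul]
    exact (mul_le_of_le_one_left zero_le (mul_le_one₀ h1 zero_le h)).trans_lt hπw
  simp at h4

theorem below_surjective :
    Function.Surjective (below : HeightOneSpectrum (𝓞 K) → HeightOneSpectrum ℤ) := by
  intro u
  have := u.isMaximal
  obtain ⟨P, hP, hPu⟩ := Ideal.exists_maximal_ideal_liesOver_of_isIntegral (S := 𝓞 K) u.asIdeal
  exact ⟨⟨P, hP.isPrime, Ideal.ne_bot_of_liesOver_of_ne_bot u.ne_bot P⟩,
    HeightOneSpectrum.ext hPu.over.symm⟩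

theorem mem_integralAdeles_of_baseChange {x : QAdele}
    (h : (baseChange x : KAdele K) ∈ integralAdeles (𝓞 K) K) : x ∈ integralAdeles ℤ ℚ := by
  intro u
  obtain ⟨v, rfl⟩ := below_surjective (K := K) u
  exact valued_le_one_of_localMap v (h v)

/-- The map `x ↦ v + x u` from the adeles of `ℚ` is proper: compact sets are covered by finitely
many cosets of `∏ r_v`, and `x u` is integral only if `x` has bounded denominators. -/
theorem isCompact_preimage_add_baseChange_mul {C : Set (KAdele K)} (hC : IsCompact C)
    (v : KAdele K) {u : K} (hu : u ≠ 0) :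
    IsCompact ((fun x : QAdele ↦ v + baseChange x * algebraMap K (KAdele K) u) ⁻¹' C) := by
  set g : QAdele → KAdele K := fun x ↦ v + baseChange x * algebraMap K (KAdele K) u with hg
  have hgc : Continuous g := continuous_const.add (continuous_baseChange.mul continuous_const)
  obtain ⟨d, hd0, hd⟩ := ((IsFractionRing.isAlgebraic_iff ℤ ℚ K).mpr
    (Algebra.IsAlgebraic.isAlgebraic u⁻¹)).exists_integral_multiple
  rw [zsmul_eq_mul] at hd
  have hdQ : (d : ℚ) ≠ 0 := Int.cast_ne_zero.mpr hd0
  have key : ∀ x : QAdele, baseChange x * algebraMap K (KAdele K) u ∈ integralAdeles (𝓞 K) K →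
      x ∈ (fun y ↦ algebraMap ℚ QAdele (d : ℚ)⁻¹ * y) '' integralAdeles ℤ ℚ := by
    intro x hx
    refine ⟨algebraMap ℚ QAdele d * x, mem_integralAdeles_of_baseChange (K := K) fun w ↦ ?_, ?_⟩
    · have e : (baseChange (algebraMap ℚ QAdele d * x) : KAdele K) w =
          (((d * u⁻¹ : K) : w.adicCompletion K)) *
            (baseChange x * algebraMap K (KAdele K) u : KAdele K) w := by
        have h1 : ((d * u⁻¹ : K) : w.adicCompletion K) =
            (d : w.adicCompletion K) * ((u : K) : w.adicCompletion K)⁻¹ := by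
          change algebraMap K (w.adicCompletion K) (d * u⁻¹) =
            _ * (algebraMap K (w.adicCompletion K) u)⁻¹
          rw [map_mul, map_inv₀, map_intCast]
        have h2 : ((u : K) : w.adicCompletion K) ≠ 0 :=
          (map_ne_zero (algebraMap K (w.adicCompletion K))).mpr hu
        have h3 : (baseChange (algebraMap ℚ QAdele d) : KAdele K) w = (d : w.adicCompletion K) := by
          rw [map_intCast, map_intCast, ← map_intCast (algebraMap K (KAdele K)),
            FiniteAdeleRing.algebraMap_apply]
          exact map_intCast (algebraMap K (w.adicCompletion K)) d
        rw [map_mul, adele_mul_apply, adele_mul_apply, h1, h3, FiniteAdeleRing.algebraMap_apply]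
        field_simp
      rw [e, map_mul]
      refine mul_le_one₀ ?_ zero_le (hx w)
      rw [HeightOneSpectrum.valuedAdicCompletion_eq_valuation']
      exact w.valuation_le_one (K := K) (⟨d * u⁻¹, hd⟩ : 𝓞 K)
    · change _ * (_ * x) = x
      rw [← mul_assoc, ← map_mul, inv_mul_cancel₀ hdQ, map_one, one_mul]
  have hcoset : ∀ c : KAdele K, ∃ D : Set QAdele, IsCompact D ∧
      ∀ x, g x - c ∈ integralAdeles (𝓞 K) K → x ∈ D := by
    intro c
    by_cases h : ∃ x₀, g x₀ - c ∈ integralAdeles (𝓞 K) K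
    · obtain ⟨x₀, hx₀⟩ := h
      refine ⟨(fun y ↦ x₀ + y) '' ((fun y ↦ algebraMap ℚ QAdele (d : ℚ)⁻¹ * y) ''
        integralAdeles ℤ ℚ), (isCompact_integralAdeles.image
          (continuous_const.mul continuous_id)).image (continuous_const.add continuous_id),
        fun x hx ↦ ⟨x - x₀, key _ fun w ↦ ?_, add_sub_cancel _ _⟩⟩
      have e : baseChange (x - x₀) * algebraMap K (KAdele K) u = (g x - c) - (g x₀ - c) := by
        rw [hg, map_sub]
        ring
      rw [e, adele_sub_apply]
      exact Valuation.map_sub_le (v := Valued.v) (hx w) (hx₀ w)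
    · exact ⟨∅, isCompact_empty, fun x hx ↦ (h ⟨x, hx⟩).elim⟩
  choose D hD hgD using hcoset
  have hopen : ∀ c : KAdele K, {y : KAdele K | y - c ∈ integralAdeles (𝓞 K) K} ∈ nhds c := by
    intro c
    refine (isOpen_integralAdeles.preimage (continuous_id.sub continuous_const)).mem_nhds ?_
    intro w
    simp
  obtain ⟨t, -, ht⟩ := hC.elim_nhds_subcover _ fun c _ ↦ hopen c
  refine (t.isCompact_biUnion fun c _ ↦ hD c).of_isClosed_subset (hC.isClosed.preimage hgc)
    fun x hx ↦ ?_
  obtain ⟨c, hc, hxc⟩ := Set.mem_iUnion₂.mp (ht hx)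
  exact Set.mem_iUnion₂.mpr ⟨c, hc, hgD c x hxc⟩

theorem IsSchwartzBruhat.integrable_comp {Φ : KAdele K → ℂ} (hΦ : IsSchwartzBruhat Φ)
    (v : KAdele K) {u : K} (hu : u ≠ 0) :
    Integrable (fun x : QAdele ↦ Φ (v + baseChange x * algebraMap K (KAdele K) u))
      (Measure.addHaar : Measure QAdele) := by
  have hgc : Continuous fun x : QAdele ↦ v + baseChange x * algebraMap K (KAdele K) u :=
    continuous_const.add (continuous_baseChange.mul continuous_const)
  refine (hΦ.1.continuous.comp hgc).integrable_of_hasCompactSupport ?_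
  refine HasCompactSupport.intro (isCompact_preimage_add_baseChange_mul hΦ.2 v hu) fun x hx ↦ ?_
  exact image_eq_zero_of_notMem_tsupport (f := Φ) hx

/-! ### The second regularity condition -/

open scoped Classical in
/-- The finite adele of `ℚ` with component `1` at `u` and `0` elsewhere. -/
def idempotentAt (u : HeightOneSpectrum ℤ) : QAdele :=
  ⟨fun w ↦ if w = u then 1 else 0, .of_forall fun w ↦ by
    change (if w = u then 1 else 0) ∈ w.adicCompletionIntegers ℚ
    split_ifs
    exacts [(w.adicCompletionIntegers ℚ).one_mem, (w.adicCompletionIntegers ℚ).zero_mem]⟩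

open scoped Classical in
theorem baseChange_idempotentAt (u : HeightOneSpectrum ℤ) (v : HeightOneSpectrum (𝓞 K)) :
    (baseChange (idempotentAt u) : KAdele K) v = if below v = u then 1 else 0 := by
  change localMap v (if below v = u then 1 else 0) = _
  split_ifs
  exacts [map_one _, map_zero _]

/-- The difference operator `1 - N(𝔭) (π_𝔭⁻¹)^*` kills averages over the translates by
`0, u, …, (p - 1) u` in the components above `p`: of the `p` translates of an adele that is
integral above `p`, exactly one is divisible by `𝔭`. -/
theorem sum_translates_eq_zero {Φ : KAdele K → ℂ} {S : Set (HeightOneSpectrum (𝓞 K))}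
    (hΦ : IsUnramifiedOutside Φ S) {v : HeightOneSpectrum (𝓞 K)}
    (hv : (Ideal.absNorm v.asIdeal).Prime) (hS : ∀ w, below w = below v → w ∉ S) {u : K}
    (hu : ∀ w : HeightOneSpectrum (𝓞 K), below w = below v → w.valuation K u = 1) (y : KAdele K) :
    ∑ a ∈ Finset.range (Ideal.absNorm v.asIdeal),
      (Φ (y + baseChange (a * idempotentAt (below v)) * algebraMap K (KAdele K) u) -
        Ideal.absNorm v.asIdeal * Φ ((((primeIdele v)⁻¹ : (KAdele K)ˣ) : KAdele K) *
          (y + baseChange (a * idempotentAt (below v)) * algebraMap K (KAdele K) u))) = 0 := by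
  classical
  set p := Ideal.absNorm v.asIdeal with hp
  set Y : ℕ → KAdele K := fun a ↦
    y + baseChange (a * idempotentAt (below v)) * algebraMap K (KAdele K) u with hY
  set ϖ : (KAdele K)ˣ := (primeIdele v)⁻¹ with hϖ
  have hnat (a : ℕ) (w : HeightOneSpectrum (𝓞 K)) :
      ((a : KAdele K) w : w.adicCompletion K) = (a : w.adicCompletion K) := by
    rw [← map_natCast (algebraMap K (KAdele K)), FiniteAdeleRing.algebraMap_apply]
    exact map_natCast (algebraMap K (w.adicCompletion K)) a
  have hYon (a : ℕ) {w} (hw : below w = below v) :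
      Y a w = y w + a * ((u : K) : w.adicCompletion K) := by
    simp only [hY, map_mul, map_natCast, adele_add_apply, adele_mul_apply, hnat,
      baseChange_idempotentAt, if_pos hw, mul_one, FiniteAdeleRing.algebraMap_apply]
  have hYoff (a : ℕ) {w} (hw : below w ≠ below v) : Y a w = y w := by
    simp only [hY, map_mul, map_natCast, adele_add_apply, adele_mul_apply, hnat,
      baseChange_idempotentAt, if_neg hw, mul_zero, zero_mul, add_zero]
  have hau (a : ℕ) {w : HeightOneSpectrum (𝓞 K)} (hw : below w = below v) :
      Valued.v ((a : w.adicCompletion K) * ((u : K) : w.adicCompletion K)) ≤ 1 := by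
    rw [map_mul, HeightOneSpectrum.valuedAdicCompletion_eq_valuation', hu w hw, mul_one]
    have : (a : w.adicCompletion K) = ((a : ℚ) : w.adicCompletion K) := by simp
    rw [this, valued_ratCast]
    simpa using valuation_intCast_le_one w (a : ℤ)
  have hYint (a : ℕ) (w : HeightOneSpectrum (𝓞 K)) :
      Valued.v (Y a w) ≤ 1 ↔ Valued.v (y w) ≤ 1 := by
    by_cases hw : below w = below v
    · rw [hYon a hw, valuation_add_le_one_iff _ (hau a hw)]
    · rw [hYoff a hw]
  have h1 (a : ℕ) : Φ (Y a) = Φ y :=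
    hΦ.congr (fun w hw ↦ hYoff a fun h ↦ hS w h hw) fun w _ ↦ hYint a w
  have hϖv : Valued.v ((ϖ : KAdele K) v) = WithZero.exp 1 := by
    rw [hϖ, units_inv_apply, map_inv₀, valued_primeIdele_same, ← WithZero.exp_neg, neg_neg]
  have hϖw {w} (hw : w ≠ v) : (ϖ : KAdele K) w = 1 := by
    rw [hϖ, units_inv_apply, primeIdele_apply_of_ne hw, inv_one]
  have hdiv (x : v.adicCompletion K) :
      Valued.v ((ϖ : KAdele K) v * x) ≤ 1 ↔ Valued.v x < 1 := by
    rw [map_mul, hϖv, lt_one_iff_le_exp_neg_one, WithZero.exp_neg, ← one_div,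
      le_div_iff₀ (zero_lt_iff.mpr WithZero.exp_ne_zero), mul_comm]
  have h2 : ∑ a ∈ Finset.range p, Φ (ϖ * Y a) = Φ y := by
    by_cases hy : ∀ w ∉ S, Valued.v (y w) ≤ 1
    · obtain ⟨b, hb, hab⟩ := exists_valued_add_mul_lt_one_iff hv (hy v (hS v rfl))
        (u := ((u : K) : v.adicCompletion K))
        (by rw [HeightOneSpectrum.valuedAdicCompletion_eq_valuation', hu v rfl])
      rw [Finset.sum_eq_single_of_mem b (Finset.mem_range.mpr hb)]
      · refine hΦ.congr (fun w hw ↦ ?_) fun w hw ↦ iff_of_true ?_ (hy w hw)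
        · have hwv : below w ≠ below v := fun h ↦ hS w h hw
          rw [adele_mul_apply, hϖw fun h ↦ hwv (by rw [h]), one_mul, hYoff b hwv]
        · by_cases hwv : w = v
          · subst hwv
            rw [adele_mul_apply, hdiv, hYon b rfl]
            exact (hab b hb).mpr rfl
          · rw [adele_mul_apply, hϖw hwv, one_mul, hYint]
            exact hy w hw
      · intro a ha hne
        by_contra h0
        have := hΦ.integral h0 v (hS v rfl)
        rw [adele_mul_apply, hdiv, hYon a rfl] at this
        exact hne ((hab a (Finset.mem_range.mp ha)).mp this)
    · push Not at hy
      obtain ⟨w, hw, hyw⟩ := hy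
      have h0 : Φ y = 0 := by
        by_contra h0
        exact hyw.not_ge (hΦ.integral h0 w hw)
      rw [h0]
      refine Finset.sum_eq_zero fun a _ ↦ ?_
      by_contra ha
      have := hΦ.integral ha w hw
      refine hyw.not_ge ((hYint a w).mp ?_)
      by_cases hwv : w = v
      · subst hwv
        rw [adele_mul_apply, hdiv] at this
        exact this.le
      · rwa [adele_mul_apply, hϖw hwv, one_mul] at this
  rw [Finset.sum_sub_distrib, ← Finset.mul_sum, h2, Finset.sum_congr rfl fun a _ ↦ h1 a,
    Finset.sum_const, Finset.card_range, nsmul_eq_mul, sub_self]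

theorem integral_eq_zero_of_sum_translates {Φ : KAdele K → ℂ} (hΦ : IsSchwartzBruhat Φ) {u : K}
    (hu : u ≠ 0) {p : ℕ} (hp : p ≠ 0) (e : QAdele)
    (h : ∀ y : KAdele K, ∑ a ∈ Finset.range p,
      Φ (y + baseChange (a * e) * algebraMap K (KAdele K) u) = 0) (v : KAdele K) :
    ∫ x : QAdele, Φ (v + baseChange x * algebraMap K (KAdele K) u)
      ∂(Measure.addHaar : Measure QAdele) = 0 := by
  set f : QAdele → ℂ := fun x ↦ Φ (v + baseChange x * algebraMap K (KAdele K) u) with hf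
  have hfi : Integrable f (Measure.addHaar : Measure QAdele) := hΦ.integrable_comp v hu
  have h1 : ∀ x, ∑ a ∈ Finset.range p, f (x + a * e) = 0 := by
    intro x
    rw [← h (v + baseChange x * algebraMap K (KAdele K) u)]
    refine Finset.sum_congr rfl fun a _ ↦ ?_
    simp only [hf, map_add, add_mul, add_assoc]
  have h2 : (p : ℂ) * ∫ x, f x ∂(Measure.addHaar : Measure QAdele) = 0 := by
    calc (p : ℂ) * ∫ x, f x ∂(Measure.addHaar : Measure QAdele)
        = ∑ a ∈ Finset.range p, ∫ x, f (x + a * e) ∂(Measure.addHaar : Measure QAdele) := by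
          simp_rw [integral_add_right_eq_self f]
          rw [Finset.sum_const, Finset.card_range, nsmul_eq_mul]
      _ = ∫ x, ∑ a ∈ Finset.range p, f (x + a * e) ∂(Measure.addHaar : Measure QAdele) :=
          (integral_finsetSum _ fun a _ ↦ hfi.comp_add_right _).symm
      _ = 0 := by simp_rw [h1, integral_zero]
  exact (mul_eq_zero.mp h2).resolve_left (Nat.cast_ne_zero.mpr hp)

/-! ### The first regularity condition -/

/-- The difference operator `1 - (π_𝔮)^*` cancels at adeles that are integral at `𝔮`, and the
shifted function allows at most a simple pole there. -/
theorem support_sub_comp_primeIdele {Φ : KAdele K → ℂ} {S : Set (HeightOneSpectrum (𝓞 K))}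
    (hΦ : IsUnramifiedOutside Φ S) {v : HeightOneSpectrum (𝓞 K)} (hv : v ∉ S) {x : KAdele K}
    (hx : Φ x - Φ (primeIdele v * x) ≠ 0) :
    (∀ w ∉ S, w ≠ v → Valued.v (x w) ≤ 1) ∧ 1 < Valued.v (x v) ∧
      Valued.v (x v) ≤ WithZero.exp 1 := by
  have h1 : 1 < Valued.v (x v) := by
    by_contra h
    rw [not_lt] at h
    refine hx (sub_eq_zero.mpr (hΦ.congr (fun w hw ↦ ?_) fun w hw ↦ ?_))
    · rw [adele_mul_apply, primeIdele_apply_of_ne fun h : w = v ↦ hv (h ▸ hw), one_mul]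
    · by_cases hwv : w = v
      · subst hwv
        refine iff_of_true h ?_
        rw [adele_mul_apply, map_mul, valued_primeIdele_same]
        exact mul_le_one₀ ((lt_one_iff_le_exp_neg_one _).mpr le_rfl).le zero_le h
      · rw [adele_mul_apply, primeIdele_apply_of_ne hwv, one_mul]
  have h0 : Φ x = 0 := by
    by_contra h0
    exact h1.not_ge (hΦ.integral h0 v hv)
  rw [h0, zero_sub, neg_ne_zero] at hx
  refine ⟨fun w hw hwv ↦ ?_, h1, ?_⟩
  · have := hΦ.integral hx w hw
    rwa [adele_mul_apply, primeIdele_apply_of_ne hwv, one_mul] at this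
  · have := hΦ.integral hx v hv
    rw [adele_mul_apply, map_mul, valued_primeIdele_same, WithZero.exp_neg,
      inv_mul_le_iff₀ (zero_lt_iff.mpr WithZero.exp_ne_zero), mul_one] at this
    exact this

/-- A rational approximation of the component of `x` at `u`, chosen to be `0` if `x = 0`. -/
theorem exists_ratCast_sub_le_one (u : HeightOneSpectrum ℤ) (x : QAdele) :
    ∃ r : ℚ, Valued.v (x u - (r : u.adicCompletion ℚ)) ≤ 1 ∧ (x = 0 → r = 0) := by
  by_cases hx : x = 0
  · exact ⟨0, by simp [hx], fun _ ↦ rfl⟩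
  · obtain ⟨r, hr⟩ := exists_field_sub_lt u (x u) one_ne_zero
    have : ((r : ℚ) : u.adicCompletion ℚ) = algebraMap ℚ (u.adicCompletion ℚ) r :=
      (eq_ratCast _ _).symm
    refine ⟨r, ?_, fun h ↦ absurd h hx⟩
    rw [this]
    exact hr.le

/-- An adele `∑ x_i u_i` agrees, up to integral elements above `q`, with an element `∑ r_i u_i` of
`K` for which the `r_i` are rational approximations of the components of `x_i` at `q`. -/
theorem conditionP1_of_support {Φ : KAdele K → ℂ} {Λ : Cone K}
    (b : Module.Basis (Fin (Module.finrank ℚ K)) ℚ K) (hb : ∀ i, b i = (Λ i : K))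
    {v : HeightOneSpectrum (𝓞 K)}
    (hu : ∀ (i) (w : HeightOneSpectrum (𝓞 K)), below w = below v →
      w.valuation K (Λ i : K) ≤ 1)
    (hl : ∀ (i) (y : K),
      (∀ w : HeightOneSpectrum (𝓞 K), below w = below v → w ≠ v → w.valuation K y ≤ 1) →
      1 < v.valuation K y → v.valuation K y ≤ WithZero.exp 1 →
      b.coord i y ≠ 0)
    (hΦ : ∀ x : KAdele K, Φ x ≠ 0 →
      (∀ w, below w = below v → w ≠ v → Valued.v (x w) ≤ 1) ∧ 1 < Valued.v (x v) ∧
        Valued.v (x v) ≤ WithZero.exp 1) : ConditionP1 Φ Λ := by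
  rintro x ⟨i, hi⟩
  by_contra h0
  obtain ⟨h1, h2, h3⟩ := hΦ _ h0
  set y : KAdele K := ∑ i, baseChange (x i) * algebraMap K (KAdele K) (Λ i : K) with hy
  choose r hr hr0 using fun i ↦ exists_ratCast_sub_le_one (below v) (x i)
  set y' : K := ∑ i, (r i : K) * (Λ i : K) with hy'
  have hsub (w : HeightOneSpectrum (𝓞 K)) (hw : below w = below v) :
      Valued.v (y w - ((y' : K) : w.adicCompletion K)) ≤ 1 := by
    have hrw (j) : Valued.v (x j (below w) - (r j : (below w).adicCompletion ℚ)) ≤ 1 := by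
      rw [hw]
      exact hr j
    have e : y w - ((y' : K) : w.adicCompletion K) =
        ∑ j, localMap w (x j (below w) - (r j : (below w).adicCompletion ℚ)) *
          ((Λ j : K) : w.adicCompletion K) := by
      have e1 : ((y' : K) : w.adicCompletion K) =
          ∑ j, (r j : w.adicCompletion K) * ((Λ j : K) : w.adicCompletion K) := by
        change algebraMap K (w.adicCompletion K) y' = ∑ j, _ * algebraMap K (w.adicCompletion K) _
        rw [hy', map_sum]
        exact Finset.sum_congr rfl fun j _ ↦ by rw [map_mul, map_ratCast]
      rw [e1, hy, adele_sum_apply, ← Finset.sum_sub_distrib]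
      refine Finset.sum_congr rfl fun j _ ↦ ?_
      rw [adele_mul_apply, baseChange_apply, FiniteAdeleRing.algebraMap_apply, map_sub,
        map_ratCast, sub_mul]
    rw [e]
    refine Valuation.map_sum_le _ fun j _ ↦ ?_
    rw [map_mul, HeightOneSpectrum.valuedAdicCompletion_eq_valuation']
    refine mul_le_one₀ ?_ zero_le (hu j w hw)
    exact localMap_mapsTo w ((HeightOneSpectrum.mem_adicCompletionIntegers ℤ ℚ _).mpr (hrw j))
  have hint (w : HeightOneSpectrum (𝓞 K)) (hw : below w = below v) :
      w.valuation K y' ≤ 1 ↔ Valued.v (y w) ≤ 1 := by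
    rw [← HeightOneSpectrum.valuedAdicCompletion_eq_valuation', ← valuation_add_le_one_iff
      (x := ((y' : K) : w.adicCompletion K)) _ (hsub w hw), add_sub_cancel]
  refine hl i y' (fun w hw hwv ↦ (hint w hw).mpr (h1 w hw hwv)) ?_ ?_ ?_
  · rw [← not_le, hint v rfl, not_le]
    exact h2
  · rw [← HeightOneSpectrum.valuedAdicCompletion_eq_valuation',
      ← sub_sub_cancel (y v) ((y' : K) : v.adicCompletion K)]
    refine Valuation.map_sub_le (v := Valued.v) h3 ((hsub v rfl).trans ?_)
    rw [← WithZero.exp_zero, WithZero.exp_le_exp]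
    exact zero_le_one
  · have : y' = ∑ j, r j • b j := by
      rw [hy']
      refine Finset.sum_congr rfl fun j _ ↦ ?_
      rw [Algebra.smul_def, eq_ratCast, hb]
    rw [this, Module.Basis.coord_apply, Module.Basis.repr_sum_self]
    exact hr0 i hi

/-! ### Regularity for almost all pairs of primes -/

theorem primesBelow_mono {S T : Finset (HeightOneSpectrum (𝓞 K))} (h : S ⊆ T) :
    primesBelow S ⊆ primesBelow T :=
  Finset.biUnion_subset_biUnion_of_subset_left _ h

theorem finite_valuation_ne_one {u : K} (hu : u ≠ 0) :
    {v : HeightOneSpectrum (𝓞 K) | v.valuation K u ≠ 1}.Finite := by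
  have h (x : K) : {v : HeightOneSpectrum (𝓞 K) | 1 < v.valuation K x}.Finite :=
    HeightOneSpectrum.Support.finite (𝓞 K) x
  refine ((h u).union (h u⁻¹)).subset fun v hv ↦ ?_
  rcases lt_or_gt_of_ne (hv : v.valuation K u ≠ 1) with h1 | h1
  · right
    change 1 < v.valuation K u⁻¹
    rw [map_inv₀]
    exact (one_lt_inv₀ (zero_lt_iff.mpr ((Valuation.ne_zero_iff _).mpr hu))).mpr h1
  · exact Or.inl h1

theorem exists_isRegular_smoothing (χ : HeckeCharacter K) (z : MonoidAlgebra ℂ (IdealGroup K))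
    {Λ : Cone K} (hΛ : Λ.IsSimple) :
    ∃ S : Finset (HeightOneSpectrum (𝓞 K)), ∀ 𝔭 𝔮 : HeightOneSpectrum (𝓞 K),
      (𝔭, 𝔮) ∈ primePairs K → Ideal.absNorm 𝔭.asIdeal ∉ primesBelow S →
      Ideal.absNorm 𝔮.asIdeal ∉ primesBelow S →
      IsRegular (χ.groupRingFunction (χ.smoothing 𝔭 𝔮 * z)) Λ := by
  classical
  obtain ⟨S₀, hS₀, hz⟩ := exists_isUnramifiedOutside_groupRingFunction χ z
  have hΛ' : LinearIndependent ℚ fun i ↦ (Λ i : K) := hΛ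
  let b := basisOfLinearIndependentOfCardEqFinrank' _ hΛ' (Fintype.card_fin _)
  have hb (i) : b i = (Λ i : K) :=
    congrFun (coe_basisOfLinearIndependentOfCardEqFinrank' _ hΛ' (Fintype.card_fin _)) i
  have hb0 (i) : b.coord i ≠ 0 := fun h ↦ by
    have := LinearMap.congr_fun h (b i)
    simp at this
  choose S₁ hS₁ using fun i ↦ exists_functional_ne_zero (b.coord i) (hb0 i)
  set S₂ : Finset (HeightOneSpectrum (𝓞 K)) :=
    Finset.univ.biUnion fun i ↦ (finite_valuation_ne_one (Λ i).2).toFinset with hS₂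
  refine ⟨hS₀.toFinset ∪ (finite_ramified χ).toFinset ∪ S₂ ∪ Finset.univ.biUnion S₁,
    fun 𝔭 𝔮 ⟨h𝔭, h𝔮, h𝔭𝔮⟩ hp hq ↦ ?_⟩
  set S := hS₀.toFinset ∪ (finite_ramified χ).toFinset ∪ S₂ ∪ Finset.univ.biUnion S₁ with hS
  have hmem (v w : HeightOneSpectrum (𝓞 K)) (hv : (Ideal.absNorm v.asIdeal).Prime)
      (hvS : Ideal.absNorm v.asIdeal ∉ primesBelow S) (hw : below w = below v) :
      w ∉ S₀ ∧ χ.IsUnramifiedAt w ∧ ∀ i, w.valuation K (Λ i : K) = 1 := by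
    have h := notMem_of_notMem_primesBelow hv hvS hw
    simp only [hS, hS₂, Finset.mem_union, Set.Finite.mem_toFinset, not_or, Finset.mem_biUnion,
      Finset.mem_univ, true_and, not_exists] at h
    exact ⟨h.1.1.1, not_not.mp h.1.1.2, fun i ↦ not_not.mp (h.1.2 i)⟩
  have hne : below 𝔭 ≠ below 𝔮 := below_ne_of_absNorm_ne h𝔭 h𝔮 h𝔭𝔮
  set H := χ.groupRingFunction z with hH
  set p := Ideal.absNorm 𝔭.asIdeal with hpdef
  have hF := χ.groupRingFunction_smoothing_mul (hmem 𝔭 𝔭 h𝔭 hp rfl).2.1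
    (hmem 𝔮 𝔮 h𝔮 hq rfl).2.1 z
  have hSB := isSchwartzBruhat_groupRingFunction χ (χ.smoothing 𝔭 𝔮 * z)
  refine ⟨hSB, ?_, fun j v ↦ ?_⟩
  · -- The function is `Ψ - (π_𝔮)^* Ψ`, where `Ψ` is unramified outside `S₀` and `𝔭`.
    set Ψ : KAdele K → ℂ := fun x ↦ H x - p * H (((primeIdele 𝔭)⁻¹ : (KAdele K)ˣ) * x) with hΨ
    have hΨu : IsUnramifiedOutside Ψ (insert 𝔭 S₀) := by
      have h := hz.mono (Set.subset_insert 𝔭 S₀)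
      refine h.sub ((h.comp_unit_mul _ fun w hw ↦ ?_).const_mul _)
      rw [units_inv_apply, primeIdele_apply_of_ne fun h : w = 𝔭 ↦ hw (Or.inl h), inv_one,
        map_one]
    have hoff (w : HeightOneSpectrum (𝓞 K)) (hw : below w = below 𝔮) : w ∉ insert 𝔭 S₀ := by
      rw [Set.mem_insert_iff, not_or]
      exact ⟨fun h ↦ hne (by rw [← h, hw]), (hmem 𝔮 w h𝔮 hq hw).1⟩
    refine conditionP1_of_support b hb (v := 𝔮) (fun i w hw ↦ ((hmem 𝔮 w h𝔮 hq hw).2.2 i).le)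
      (fun i y h1 h2 h3 ↦ hS₁ i 𝔮 h𝔮 (fun h ↦ hq (primesBelow_mono ?_ h)) y h1 h2 h3)
      fun x hx ↦ ?_
    · exact (Finset.subset_biUnion_of_mem S₁ (Finset.mem_univ i)).trans
        Finset.subset_union_right
    · have hx' : Ψ x - Ψ (primeIdele 𝔮 * x) ≠ 0 := by
        intro h0
        refine hx ?_
        rw [hF, ← h0]
        simp only [hΨ]
        rw [mul_left_comm (primeIdele 𝔮 : KAdele K)]
        ring
      obtain ⟨h1, h2, h3⟩ := support_sub_comp_primeIdele hΨu (hoff 𝔮 rfl) hx'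
      exact ⟨fun w hw hwq ↦ h1 w (hoff w hw) hwq, h2, h3⟩
  · -- The function is `G - p (π_𝔭⁻¹)^* G`, where `G` is unramified outside `S₀` and `𝔮`.
    set G : KAdele K → ℂ := fun x ↦ H x - H (primeIdele 𝔮 * x) with hG
    have hGu : IsUnramifiedOutside G (insert 𝔮 S₀) := by
      have h := hz.mono (Set.subset_insert 𝔮 S₀)
      refine h.sub (h.comp_unit_mul _ fun w hw ↦ ?_)
      rw [primeIdele_apply_of_ne fun h : w = 𝔮 ↦ hw (Or.inl h), map_one]
    refine integral_eq_zero_of_sum_translates hSB (Λ j).2 h𝔭.ne_zero (idempotentAt (below 𝔭))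
      (fun y ↦ ?_) v
    rw [← sum_translates_eq_zero hGu h𝔭 (fun w hw ↦ ?_)
      (fun w hw ↦ (hmem 𝔭 w h𝔭 hp hw).2.2 j) y]
    · exact Finset.sum_congr rfl fun a _ ↦ hF _
    · rw [Set.mem_insert_iff, not_or]
      exact ⟨fun h ↦ hne (by rw [← hw, h]), (hmem 𝔭 w h𝔭 hp hw).1⟩

end CassouNogues

end

theorem mainTheorem5 {K : Type*} [Field K] [NumberField K] [NumberField.IsTotallyReal K]
    (χ : CassouNogues.HeckeCharacter K)
    (z : MonoidAlgebra ℂ (CassouNogues.IdealGroup K))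
    (T : Set (CassouNogues.Cone K)) (hT : T.Finite) (hT' : ∀ Λ ∈ T, Λ.IsSimple) :
    CassouNogues.ForAlmostAllPairs fun 𝔭 𝔮 : IsDedekindDomain.HeightOneSpectrum (𝓞 K) ↦
      ∀ Λ ∈ T, CassouNogues.IsRegular (χ.groupRingFunction (χ.smoothing 𝔭 𝔮 * z)) Λ := by
  classical
  choose S hS using fun Λ : T ↦ CassouNogues.exists_isRegular_smoothing χ z (hT' Λ Λ.2)
  have := hT.fintype
  refine ⟨CassouNogues.primesBelow (Finset.univ.biUnion S),
    fun p hp ↦ CassouNogues.prime_of_mem_primesBelow hp, fun 𝔭 𝔮 h𝔭𝔮 hp hq Λ hΛ ↦ ?_⟩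
  have hsub : CassouNogues.primesBelow (S ⟨Λ, hΛ⟩) ⊆
      CassouNogues.primesBelow (Finset.univ.biUnion S) :=
    CassouNogues.primesBelow_mono (Finset.subset_biUnion_of_mem S (Finset.mem_univ _))
  exact hS ⟨Λ, hΛ⟩ 𝔭 𝔮 h𝔭𝔮 (fun h ↦ hp (hsub h)) fun h ↦ hq (hsub h)
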